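/- **Setting.** Let $b:\mathbb R\to\mathbb R$, $\phi^*>0$, a measurable $c\ge 0$ and a reference measure $\nu$ on $\mathbb R$ be such that $y\mapsto \exp\{(y\theta-b(\theta))/\phi^*\}c(y)$ is a probability density with respect to $\nu$ for every $\theta\in\mathbb R$. For each sample size $n$ let $X\in\mathbb R^{n\times p}$ be a fixed design matrix with rows $x_i'$ and columns $X_j$, $\beta^*\in\mathbb R^p$, $\mathcal M\subseteq\{1,\dots,p\}$ with $|\mathcal M|=m$, $C\in\mathbb R^{r\times m}$ of full row rank and $t\in\mathbb R^r$ (all of these, including $p,m,r$, may depend on $n$), and let $y_1,\dots,y_n$ be independent, $y_i$ having the above density with $\theta=x_i'\beta^*$. We assume the ultra-high dimensional regime: $p\to\infty$ and $\log p=O(n^{\eta})$ for some $\eta\in(0,1)$. Put $$\ell_n(\beta)=-\tfrac1n\{y'X\beta-\textstyle\sum_i b(x_i'\beta)\},\quad \mathcal A=\{j:\beta^*_j\ne0\},\quad \tilde s=|\mathcal A|,\quad \mathcal S=\mathcal A\setminus\mathcal M,\quad s=|\mathcal S|,$$ and $\Sigma(v)=\mathrm{diag}(b''(v_1),\dots,b''(v_n))$.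 $\|\cdot\|_{\max}$, $\|\cdot\|_{\min}$ are the entrywise maximum and minimum of absolute values (the minimum over an empty index set being $+\infty$), and $\|A\|_\infty=\max_i\sum_j|a_{ij}|$ for a matrix $A$. *Penalty.* With positive constants $a,a_1,a_2$, $a>a_2$, and $\lambda=\lambda_n>0$, the penalty $p_\lambda$ is increasing and concave on $[0,\infty)$ with $p_\lambda(0)=0$, differentiable on $(0,\infty)$, with $p_\lambda'(0):=p_\lambda'(0+)\ge a_1\lambda$, $p'_\lambda(t)\ge a_1\lambda$ for $0<t\le a_2\lambda$, and $p'_\lambda(t)=0$ for $t\ge a\lambda$. Put $a_0=\min\{1,a_2\}$. *Estimators.* The reduced oracle estimator $\hat\beta_0^{\rm oracle}$ minimizes $\ell_n$ over $\{\beta:\beta_{(\mathcal M\cup\mathcal S)^c}=0,\ C\beta_{\mathcal M}=t\}$, the full oracle estimator $\hat\beta_a^{\rm oracle}$ over $\{\beta:\beta_{(\mathcal M\cup\mathcal S)^c}=0\}$. $\hat\beta^{\rm lasso}$ is a minimizer of $\ell_n(\beta)+\lambda_{\rm lasso}\|\beta\|_1$. The full LLA algorithm started at $\hat\beta^{\rm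 lasso}$ sets $\hat\beta^{(0)}=\hat\beta^{\rm lasso}$ and lets $\hat\beta^{(k)}$ be a minimizer of $\ell_n(\beta)+\sum_{j\notin\mathcal M}p_\lambda'(|\hat\beta^{(k-1)}_j|)\,|\beta_j|$, $k\ge1$; the reduced LLA algorithm does the same subject to $C\beta_{\mathcal M}=t$. An LLA algorithm *converges to $\hat\beta$ in two steps* if it finds $\hat\beta$ in its first step and returns to it in the second and in every later step (minimizers exist, and this holds whichever minimizers are selected). **Assumptions.** The conditions on a single $n$ (including those said to hold with constants uniform in $n$) are assumed for all $n\ge n_0$, where $n_0\ge1$ is fixed; $O$, $o$ and $\to$ refer to $n\to\infty$. - (A1) Almost surely $\hat\beta_0^{\rm oracle}$ is the unique solution of its problem, and there is $\eta\in\mathbb R^r$ with $\nabla_{\mathcal M}\ell_n(\hat\beta_0^{\rm oracle})=C'\eta$, $\nabla_{\mathcal S}\ell_n(\hat\beta_0^{\rm oracle})=0$, and $C\hat\beta^{\rm oracle}_{0,\mathcal M}=t$. - (A2) Almost surely $\hat\beta_a^{\rm oracle}$ is the unique solution of its problem, and $\nabla_{\mathcal M\cup\mathcal S}\ell_n(\hat\beta_a^{\rm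 oracle})=0$. - (A3) $\|\beta^*_{\mathcal S}\|_{\min}>(a+1)\lambda$. - (A4) $C\beta^*_{\mathcal M}=t+h_n$ with $h_n\to0$, $\lambda_{\max}\{(CC')^{-1}\}=O(1)$, and $\|h_n\|_2=O(\sqrt{\min\{s+m-r,r\}/n})$. - (A5) $\max\{\sqrt{s+m},\sqrt{\log p}\}/\sqrt n=o(\lambda)$. - (A6) With $\mathcal N_0=\{\beta:\|\beta_{\mathcal M\cup\mathcal S}-\beta^*_{\mathcal M\cup\mathcal S}\|_2\le\sqrt{(s+m)\log n/n},\ \beta_{(\mathcal M\cup\mathcal S)^c}=0\}$: there is $c>0$ such that $\inf_{\beta\in\mathcal N_0}\lambda_{\min}\{X_{\mathcal M\cup\mathcal S}'\Sigma(X\beta)X_{\mathcal M\cup\mathcal S}\}\ge cn$ for all large $n$; $\sup_{\beta\in\mathcal N_0}\max_j\lambda_{\max}\{X_{\mathcal M\cup\mathcal S}'\,\mathrm{diag}(|x_{ij}|\,|b'''(x_i'\beta)|)_{i}\,X_{\mathcal M\cup\mathcal S}\}=O(n)$; $\lambda_{\max}\{X_{\mathcal M\cup\mathcal S}'\Sigma(X\beta^*)X_{\mathcal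 M\cup\mathcal S}\}=O(n)$; and $\|X_{(\mathcal M\cup\mathcal S)^c}'\Sigma(X\beta^*)X_{\mathcal M\cup\mathcal S}\|_\infty=O(n)$. - (A7) There are constants $B_1,B_2$ with $\max_j\|X_j\|_2^2\le B_1n$ and $\max_{i,j}|x_{ij}|\le B_2\sqrt{n/\log p}$. - (A8) There are constants $M,v_0>0$ with $\max_i\mathbb E\big[\exp(|e_i|/M)-1-|e_i|/M\big]M^2\le v_0/2$, where $e_i=y_i-b'(x_i'\beta^*)$. - (A9) $\kappa=\kappa_n=\min_{u\in\mathcal C}\,u'\nabla^2\ell_n(\beta^*)u/u'u\in(0,\infty)$ (the minimum exists), where $\mathcal C=\{u\ne0:\|u_{\mathcal A^c}\|_1\le3\|u_{\mathcal A}\|_1\}$. - (A10) There is $K>0$ with $|b'''(t)|\le Kb''(t)$ for all $t\in\mathbb R$. - Rates and penalty levels: $s+m=o(n^{1/2})$; $\lambda_{\rm lasso}=A\sqrt{\log p/n}$ with a constant $A>0$ such that $A^2>16(B_1v_0+\tfrac12AB_2M)$; $\lambda_{\rm lasso}\le\kappa/(20K\tilde s\,\|X\|_{\max})$; and $\lambda\ge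 5\tilde s^{1/2}\lambda_{\rm lasso}/(a_0\kappa)$. **Conclusion.** For $i\in\{0,a\}$ put $$\delta_0^{\rm lasso}=\Pr\big(\|\hat\beta^{\rm lasso}_{\mathcal M^c}-\beta^*_{\mathcal M^c}\|_{\max}>a_0\lambda\big),\quad \delta_{i1}^{\rm GLM}=\Pr\big(\|\nabla_{(\mathcal M\cup\mathcal S)^c}\ell_n(\hat\beta_i^{\rm oracle})\|_{\max}\ge a_1\lambda\big),\quad \delta_{i2}^{\rm GLM}=\Pr\big(\|\hat\beta^{\rm oracle}_{i,\mathcal S}\|_{\min}\le a\lambda\big).$$ Then for every $n\ge n_0$ the reduced LLA algorithm started at $\hat\beta^{\rm lasso}$ converges to $\hat\beta_0^{\rm oracle}$ in two steps with probability at least $1-\delta_0^{\rm lasso}-\delta_{01}^{\rm GLM}-\delta_{02}^{\rm GLM}$, and the full LLA algorithm started at $\hat\beta^{\rm lasso}$ converges to $\hat\beta_a^{\rm oracle}$ in two steps with probability at least $1-\delta_0^{\rm lasso}-\delta_{a1}^{\rm GLM}-\delta_{a2}^{\rm GLM}$. Moreover $\delta_0^{\rm lasso}$, $\delta_{01}^{\rm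 GLM}$, $\delta_{02}^{\rm GLM}$, $\delta_{a1}^{\rm GLM}$ and $\delta_{a2}^{\rm GLM}$ all tend to $0$ as $n\to\infty$. -/

import Mathlib

open MeasureTheory ProbabilityTheory Filter Topology Asymptotics
open scoped Matrix ENNReal

noncomputable section

namespace PPGLM

/-! ### Generic notions -/

/-- `x` is a minimizer of `f` over the set `F`. -/
def IsArgmin {E : Type*} (f : E → ℝ) (F : Set E) (x : E) : Prop :=
  x ∈ F ∧ ∀ z ∈ F, f x ≤ f z

/-- `x` is the one and only minimizer of `f` over the set `F`. -/
def IsUniqueArgmin {E : Type*} (f : E → ℝ) (F : Set E) (x : E) : Prop :=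
  IsArgmin f F x ∧ ∀ z, IsArgmin f F z → z = x

/-- Euclidean norm of a vector. -/
def l2norm {ι : Type*} [Fintype ι] (v : ι → ℝ) : ℝ := Real.sqrt (∑ j, v j ^ 2)

/-- The entrywise maximum norm of a matrix. -/
def maxNorm {n p : ℕ} (X : Matrix (Fin n) (Fin p) ℝ) : ℝ :=
  ⨆ q : Fin n × Fin p, |X q.1 q.2|

/-- The matrix `X_T' diag(w) X_T`, where `X_T` consists of the columns of `X` with index in `T`. -/
def weightedGram {n p : ℕ} (X : Matrix (Fin n) (Fin p) ℝ) (T : Finset (Fin p))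
    (w : Fin n → ℝ) : Matrix T T ℝ :=
  (X.submatrix id (fun j : T => (j : Fin p)))ᵀ * Matrix.diagonal w *
    X.submatrix id (fun j : T => (j : Fin p))

/-! ### Exponential families in canonical form -/

/-- A one-parameter exponential family with densities
`y ↦ exp ((y θ - b θ) / φ) * c y` with respect to a reference measure `ν` on the real line
(for example Lebesgue measure or a counting measure); every real `θ` is a parameter. -/
structure ExpFamily where
  b : ℝ → ℝ
  φ : ℝ
  c : ℝ → ℝ
  ν : Measure ℝ
  φ_pos : 0 < φ
  c_nonneg : ∀ y, 0 ≤ c y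
  c_meas : Measurable c
  normalized : ∀ θ : ℝ,
    ∫⁻ y, ENNReal.ofReal (Real.exp ((y * θ - b θ) / φ) * c y) ∂ν = 1

/-- The member of the exponential family with canonical parameter `θ`. -/
def ExpFamily.law (𝓕 : ExpFamily) (θ : ℝ) : Measure ℝ :=
  𝓕.ν.withDensity
    (fun y => ENNReal.ofReal (Real.exp ((y * θ - 𝓕.b θ) / 𝓕.φ) * 𝓕.c y))

/-! ### The loss, its gradient and its Hessian -/

/-- The loss `ℓ_n(β) = -(1/n) { y' X β - ∑ i, b (x_i' β) }`. -/
def loss {n p : ℕ} (b : ℝ → ℝ) (X : Matrix (Fin n) (Fin p) ℝ) (y : Fin n → ℝ)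
    (β : Fin p → ℝ) : ℝ :=
  -(1 / (n : ℝ)) * (y ⬝ᵥ (X *ᵥ β) - ∑ i, b ((X *ᵥ β) i))

/-- The gradient `-(1/n) X' (y - b'(X β))` of the loss. -/
def gradLoss {n p : ℕ} (b : ℝ → ℝ) (X : Matrix (Fin n) (Fin p) ℝ) (y : Fin n → ℝ)
    (β : Fin p → ℝ) : Fin p → ℝ :=
  fun j => -(1 / (n : ℝ)) * (Xᵀ *ᵥ (fun i => y i - deriv b ((X *ᵥ β) i))) j

/-- The Hessian `(1/n) X' diag(b''(X β)) X` of the loss. -/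
def hessLoss {n p : ℕ} (b : ℝ → ℝ) (X : Matrix (Fin n) (Fin p) ℝ) (β : Fin p → ℝ) :
    Matrix (Fin p) (Fin p) ℝ :=
  (1 / (n : ℝ)) • (Xᵀ * Matrix.diagonal (fun i => iteratedDeriv 2 b ((X *ᵥ β) i)) * X)

theorem hasDerivAt_mulVec_update {n p : ℕ} (X : Matrix (Fin n) (Fin p) ℝ)
    (β : Fin p → ℝ) (j : Fin p) (i : Fin n) :
    HasDerivAt (fun t => (X *ᵥ Function.update β j t) i) (X i j) (β j) := by
  have h : (fun t => (X *ᵥ Function.update β j t) i)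
      = fun t => (X *ᵥ β) i + X i j * (t - β j) := by
    funext t
    have : Function.update β j t = β + Pi.single j (t - β j) := by
      funext k
      by_cases hk : k = j
      · subst hk; simp
      · simp [hk]
    rw [this, Matrix.mulVec_add]
    simp
  rw [h]
  simpa using (((hasDerivAt_id (β j)).sub_const (β j)).const_mul (X i j)).const_add ((X *ᵥ β) i)

/-- `gradLoss` is indeed the vector of partial derivatives of `loss`. -/
theorem hasDerivAt_loss {n p : ℕ} {b : ℝ → ℝ} (hb : Differentiable ℝ b)
    (X : Matrix (Fin n) (Fin p) ℝ) (y : Fin n → ℝ) (β : Fin p → ℝ) (j : Fin p) :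
    HasDerivAt (fun t => loss b X y (Function.update β j t)) (gradLoss b X y β j) (β j) := by
  unfold loss gradLoss
  refine HasDerivAt.const_mul _ ?_
  have h1 : HasDerivAt (fun t => y ⬝ᵥ (X *ᵥ Function.update β j t)) (∑ i, y i * X i j) (β j) := by
    unfold dotProduct
    exact HasDerivAt.fun_sum fun i _ => (hasDerivAt_mulVec_update X β j i).const_mul (y i)
  have h2 : HasDerivAt (fun t => ∑ i, b ((X *ᵥ Function.update β j t) i))
      (∑ i, deriv b ((X *ᵥ β) i) * X i j) (β j) := by
    refine HasDerivAt.fun_sum fun i _ => ?_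
    have hx : HasDerivAt b (deriv b ((X *ᵥ β) i)) ((X *ᵥ Function.update β j (β j)) i) := by
      rw [Function.update_eq_self]
      exact (hb _).hasDerivAt
    exact hx.comp (β j) (hasDerivAt_mulVec_update X β j i)
  refine (h1.sub h2).congr_deriv ?_
  rw [← Finset.sum_sub_distrib, Matrix.mulVec, dotProduct]
  exact Finset.sum_congr rfl fun i _ => by simp only [Matrix.transpose_apply]; ring

/-- `hessLoss` is indeed the matrix of second partial derivatives of `loss`. -/
theorem hasDerivAt_gradLoss {n p : ℕ} {b : ℝ → ℝ} (hb : Differentiable ℝ (deriv b))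
    (X : Matrix (Fin n) (Fin p) ℝ) (y : Fin n → ℝ) (β : Fin p → ℝ) (j k : Fin p) :
    HasDerivAt (fun t => gradLoss b X y (Function.update β k t) j) (hessLoss b X β j k) (β k) := by
  have h2 : HasDerivAt
      (fun t => ∑ i, X i j * (y i - deriv b ((X *ᵥ Function.update β k t) i)))
      (∑ i, X i j * (-(iteratedDeriv 2 b ((X *ᵥ β) i) * X i k))) (β k) := by
    refine HasDerivAt.fun_sum fun i _ => HasDerivAt.const_mul _ ?_
    have hx : HasDerivAt (deriv b) (iteratedDeriv 2 b ((X *ᵥ β) i))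
        ((X *ᵥ Function.update β k (β k)) i) := by
      rw [Function.update_eq_self, iteratedDeriv_succ, iteratedDeriv_one]
      exact (hb _).hasDerivAt
    exact (hx.comp (β k) (hasDerivAt_mulVec_update X β k i)).const_sub (y i)
  have h3 := h2.const_mul (-(1 / (n : ℝ)))
  unfold gradLoss hessLoss
  refine h3.congr_deriv ?_
  rw [Matrix.smul_apply, Matrix.mul_apply, smul_eq_mul, Finset.mul_sum, Finset.mul_sum]
  exact Finset.sum_congr rfl fun i _ => by
    rw [Matrix.mul_diagonal, Matrix.transpose_apply]; ring

/-! ### One testing problem -/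

/-- The deterministic data of one testing problem with `n` observations, `p` predictors and `r`
linear constraints: the fixed design matrix, the true coefficient vector `β*`, the index set `M`
of the tested coefficients, the constraint matrix `C` and the right-hand side `t` of the null
hypothesis `C β_M = t`. -/
structure Problem (n p r : ℕ) where
  X : Matrix (Fin n) (Fin p) ℝ
  βs : Fin p → ℝ
  M : Finset (Fin p)
  C : Matrix (Fin r) M ℝ
  t : Fin r → ℝ

namespace Problem

variable {n p r : ℕ} (D : Problem n p r)

/-- The support `A` of the true coefficient vector. -/
def A : Finset (Fin p) := Finset.univ.filter (fun j => D.βs j ≠ 0)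

/-- The important untested indices `S = A \ M`. -/
def S : Finset (Fin p) := D.A \ D.M

/-- `M ∪ S`, which is `M ∪ A`. -/
def MS : Finset (Fin p) := D.M ∪ D.S

/-- `C β_M`. -/
def Cmul (β : Fin p → ℝ) : Fin r → ℝ := D.C *ᵥ (fun j : D.M => β j)

/-- The deviation `h = C β*_M - t` of the truth from the null hypothesis. -/
def h : Fin r → ℝ := D.Cmul D.βs - D.t

/-- The coefficient vectors which satisfy the null hypothesis (reduced model). -/
def reduced : Set (Fin p → ℝ) := {β | D.Cmul β = D.t}

/-- All coefficient vectors (full model). -/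
def full (_D : Problem n p r) : Set (Fin p → ℝ) := Set.univ

/-- The coefficient vectors which vanish outside `M ∪ A`. -/
def oracleSpace : Set (Fin p → ℝ) := {β | ∀ j ∉ D.MS, β j = 0}

/-- The neighbourhood of the true vector of radius `√((s + m) log n / n)` in the coordinates
`M ∪ S`, with all other coordinates equal to zero. -/
def N0 : Set (Fin p → ℝ) :=
  {β | l2norm (fun j : D.MS => β j - D.βs j)
        ≤ Real.sqrt (((D.S.card : ℝ) + D.M.card) * Real.log n / n) ∧
      ∀ j ∉ D.MS, β j = 0}

/-- The cone of all `u ≠ 0` with `‖u_{Aᶜ}‖₁ ≤ 3 ‖u_A‖₁`. -/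
def cone : Set (Fin p → ℝ) :=
  {u | u ≠ 0 ∧ ∑ j ∈ D.Aᶜ, |u j| ≤ 3 * ∑ j ∈ D.A, |u j|}

/-- `κ` is the minimum over the cone of the Rayleigh quotient of the Hessian of the loss at the
true coefficient vector. -/
def IsRestrictedEigenvalue (b : ℝ → ℝ) (κ : ℝ) : Prop :=
  IsLeast ((fun u => (u ⬝ᵥ (hessLoss b D.X D.βs *ᵥ u)) / (u ⬝ᵥ u)) '' D.cone) κ

/-- `β` is the unique solution of the reduced oracle problem and satisfies its first order
(Lagrange) conditions. -/
def IsReducedOracle (b : ℝ → ℝ) (y : Fin n → ℝ) (β : Fin p → ℝ) : Prop :=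
  IsUniqueArgmin (loss b D.X y) (D.oracleSpace ∩ D.reduced) β ∧
  (∃ η : Fin r → ℝ,
    (∀ j : D.M, gradLoss b D.X y β j = (D.Cᵀ *ᵥ η) j) ∧
    ∀ j ∈ D.S, gradLoss b D.X y β j = 0) ∧
  D.Cmul β = D.t

/-- `β` is the unique solution of the full oracle problem and satisfies its first order
conditions. -/
def IsFullOracle (b : ℝ → ℝ) (y : Fin n → ℝ) (β : Fin p → ℝ) : Prop :=
  IsUniqueArgmin (loss b D.X y) D.oracleSpace β ∧
  ∀ j ∈ D.MS, gradLoss b D.X y β j = 0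

/-- `β` is an `ℓ₁`-penalized (lasso) estimator with penalty level `l`. -/
def IsLasso (b : ℝ → ℝ) (y : Fin n → ℝ) (l : ℝ) (β : Fin p → ℝ) : Prop :=
  IsArgmin (fun β => loss b D.X y β + l * ∑ j, |β j|) Set.univ β

/-- `seq 0, …, seq B` are the iterates of a run with `B` steps of the local linear approximation
algorithm over the feasible set `F`: the run starts at `init`, and each step minimizes over `F` the
loss plus a weighted `ℓ₁`-norm of the coordinates outside `M`, the weights being the values of the
derivative `dp` of the penalty at the absolute values of the previous iterate. -/
def IsLLARun (b : ℝ → ℝ) (y : Fin n → ℝ) (dp : ℝ → ℝ) (F : Set (Fin p → ℝ))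
    (init : Fin p → ℝ) (B : ℕ) (seq : ℕ → Fin p → ℝ) : Prop :=
  seq 0 = init ∧
  ∀ k < B, IsArgmin
    (fun β => loss b D.X y β + ∑ j ∈ D.Mᶜ, dp |seq k j| * |β j|) F (seq (k + 1))

/-- The LLA algorithm started at `init` converges to `target` in two steps: it finds `target` in
the first step and returns to it in the second and in every later step. (As the minimization
problems of the algorithm may have several solutions or none, this says that runs of every length
exist and that every run has this property, however the minimizers are selected.) -/
def LLAConvergesInTwoSteps (b : ℝ → ℝ) (y : Fin n → ℝ) (dp : ℝ → ℝ) (F : Set (Fin p → ℝ))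
    (init target : Fin p → ℝ) : Prop :=
  ∀ B : ℕ, (∃ seq, D.IsLLARun b y dp F init B seq) ∧
    ∀ seq, D.IsLLARun b y dp F init B seq → ∀ k, 1 ≤ k → k ≤ B → seq k = target

/-- The probability of `‖init_{Mᶜ} - β*_{Mᶜ}‖_max > x`. -/
def delta0 {Ω : Type*} [MeasurableSpace Ω] (P : Measure Ω) (init : Ω → Fin p → ℝ) (x : ℝ) :
    ℝ≥0∞ :=
  P {ω | ∃ j ∉ D.M, x < |init ω j - D.βs j|}

/-- The probability of `‖∇_{(M ∪ S)ᶜ} ℓ_n(est)‖_max ≥ x`. -/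
def delta1 {Ω : Type*} [MeasurableSpace Ω] (P : Measure Ω) (b : ℝ → ℝ) (Y : Fin n → Ω → ℝ)
    (est : Ω → Fin p → ℝ) (x : ℝ) : ℝ≥0∞ :=
  P {ω | ∃ j ∉ D.MS, x ≤ |gradLoss b D.X (fun i => Y i ω) (est ω) j|}

/-- The probability of `‖est_S‖_min ≤ x` (which is the empty event if `S` is empty). -/
def delta2 {Ω : Type*} [MeasurableSpace Ω] (P : Measure Ω) (est : Ω → Fin p → ℝ) (x : ℝ) :
    ℝ≥0∞ :=
  P {ω | ∃ j ∈ D.S, |est ω j| ≤ x}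

end Problem

/-! ### Folded-concave penalties -/

/-- `pen` is a folded-concave penalty at level `lam` with constants `a`, `a₁`, `a₂`, and `dp` is its
derivative on the positive half-line, extended to `0` by the right limit `dp 0 = pen'(0+)`. -/
structure IsFoldedConcave (a a₁ a₂ lam : ℝ) (pen dp : ℝ → ℝ) : Prop where
  mono : MonotoneOn pen (Set.Ici 0)
  concave : ConcaveOn ℝ (Set.Ici 0) pen
  zero : pen 0 = 0
  hasDeriv : ∀ t, 0 < t → HasDerivAt pen (dp t) t
  dp_zero : Tendsto dp (𝓝[>] 0) (𝓝 (dp 0))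
  dp_zero_ge : a₁ * lam ≤ dp 0
  dp_ge : ∀ t, 0 < t → t ≤ a₂ * lam → a₁ * lam ≤ dp t
  dp_eq_zero : ∀ t, a * lam ≤ t → dp t = 0

end PPGLM

end

open PPGLM

namespace PPGLM

/-! ### Smoothness and mean of an exponential family -/

namespace ExpFamily

variable (𝓕 : ExpFamily)

/-! The argument splits into a deterministic statement for each sample and probability bounds for
the gradient of the loss at `β*`.

Deterministic part (`argmin_weighted_iff`, `llaConvergesInTwoSteps`). The loss is convex, so it lies
above its tangent at the oracle. On differences of feasible points the tangent has no component
along `M ∪ S`, by the first order conditions. If the weights vanish on `S` and strictly dominate the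
gradient outside `M ∪ S`, the oracle is the only minimizer of the weighted problem. A lasso error of
at most `min 1 a₂ * lam` gives such weights in the first step; an oracle with `|β_j| > a * lam` on
`S` reproduces them in every later step. The failure event therefore lies, up to a null set, in the
union of the three events behind `delta0`, `delta1` and `delta2`.

Lasso (`l2norm_lasso_sub_le`). If the gradient at `β*` is at most `l / 2` in every coordinate, the
error lies in the cone. Self-concordance turns the restricted eigenvalue at `β*` alone into
quadratic growth of the loss near `β*`, which gives the rate `√s̃ l / κ`.

Oracles (`eventually_oracle_bounds`). Both oracles have a loss no larger than that of a comparison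
point `β* + d` supported on `M ∪ S`, with `d` of order `ρ = √((s+m)/n)`: `d = 0` for the full model,
the least norm correction of the constraint for the reduced one. Strong convexity on `N0` then
places the oracle within a constant multiple of `ρ` of `β*`. As `ρ` and `√(log p / n)` are both
`o(lam)`, the gradient outside `M ∪ S` stays below `a₁ * lam` and the signals on `S` stay above `a *
lam`.

Probability. A Bernstein bound and a union over the columns control the maximum of the gradient at
`β*`, with failure probability `2 / p`; second moments and Markov's inequality control its Euclidean
norm on `M ∪ S`, with failure probability `B₁ v / T²`. Letting `n → ∞` and then `T → ∞` gives the
limits. -/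

theorem measurable_density (θ : ℝ) :
    Measurable fun y => ENNReal.ofReal (Real.exp ((y * θ - 𝓕.b θ) / 𝓕.φ) * 𝓕.c y) := by
  have := 𝓕.c_meas
  fun_prop

/-- Exponential tilting: multiplying the density at `θ` by `exp (s y)` gives a constant times the
density at `θ + s φ`, which has total mass one. -/
theorem lintegral_exp_mul_law (θ s : ℝ) :
    ∫⁻ y, ENNReal.ofReal (Real.exp (s * y)) ∂(𝓕.law θ)
      = ENNReal.ofReal (Real.exp ((𝓕.b (θ + s * 𝓕.φ) - 𝓕.b θ) / 𝓕.φ)) := by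
  have hφ := 𝓕.φ_pos
  rw [law, lintegral_withDensity_eq_lintegral_mul _ (𝓕.measurable_density θ) (by fun_prop)]
  have h : ∀ y, ((fun y => ENNReal.ofReal (Real.exp ((y * θ - 𝓕.b θ) / 𝓕.φ) * 𝓕.c y)) *
        fun y => ENNReal.ofReal (Real.exp (s * y))) y
      = ENNReal.ofReal (Real.exp ((𝓕.b (θ + s * 𝓕.φ) - 𝓕.b θ) / 𝓕.φ)) *
        ENNReal.ofReal (Real.exp ((y * (θ + s * 𝓕.φ) - 𝓕.b (θ + s * 𝓕.φ)) / 𝓕.φ) * 𝓕.c y) := by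
    intro y
    have hc := 𝓕.c_nonneg y
    rw [Pi.mul_apply, ← ENNReal.ofReal_mul (by positivity), ← ENNReal.ofReal_mul (by positivity)]
    congr 1
    rw [mul_right_comm, ← Real.exp_add, ← mul_assoc, ← Real.exp_add]
    congr 2
    field_simp
    ring
  rw [lintegral_congr h, lintegral_const_mul _ (𝓕.measurable_density _), 𝓕.normalized, mul_one]

theorem integrable_exp_mul_law (θ s : ℝ) :
    Integrable (fun y => Real.exp (s * y)) (𝓕.law θ) := by
  refine ⟨by fun_prop, ?_⟩
  rw [hasFiniteIntegral_iff_ofReal (ae_of_all _ fun y => (Real.exp_pos _).le),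
    lintegral_exp_mul_law]
  exact ENNReal.ofReal_lt_top

theorem mgf_law (θ s : ℝ) :
    mgf (fun y => y) (𝓕.law θ) s = Real.exp ((𝓕.b (θ + s * 𝓕.φ) - 𝓕.b θ) / 𝓕.φ) := by
  rw [mgf, integral_eq_lintegral_of_nonneg_ae (ae_of_all _ fun y => (Real.exp_pos _).le)
    (by fun_prop), lintegral_exp_mul_law, ENNReal.toReal_ofReal (Real.exp_pos _).le]

theorem integrableExpSet_law (θ : ℝ) : integrableExpSet (fun y => y) (𝓕.law θ) = Set.univ :=
  Set.eq_univ_of_forall fun s => 𝓕.integrable_exp_mul_law θ s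

/-- Up to scaling and an additive constant, `b` is the logarithm of the moment generating function
of the law at `0`. This function is finite on the whole line, hence analytic, and it is positive. -/
theorem contDiff_b : ContDiff ℝ 3 𝓕.b := by
  have hφ := 𝓕.φ_pos
  have h : 𝓕.b = fun θ => 𝓕.b 0 + 𝓕.φ * Real.log (mgf (fun y => y) (𝓕.law 0) (θ / 𝓕.φ)) := by
    funext θ
    rw [mgf_law, Real.log_exp]
    field_simp
    simp
  have hm : ContDiff ℝ 3 (mgf (fun y => y) (𝓕.law 0)) := by
    have := analyticOnNhd_mgf (X := fun y => y) (μ := 𝓕.law 0)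
    rw [integrableExpSet_law, interior_univ] at this
    exact contDiffOn_univ.1 this.contDiffOn_of_completeSpace
  rw [h]
  refine contDiff_const.add (contDiff_const.mul (ContDiff.log (hm.comp (by fun_prop)) fun θ => ?_))
  rw [mgf_law]
  exact (Real.exp_pos _).ne'

theorem integral_law (θ : ℝ) : ∫ y, y ∂(𝓕.law θ) = deriv 𝓕.b θ := by
  have hφ := 𝓕.φ_pos
  have h0 : (0 : ℝ) ∈ interior (integrableExpSet (fun y => y) (𝓕.law θ)) := by
    rw [integrableExpSet_law, interior_univ]; trivial
  rw [← deriv_mgf_zero h0, funext (𝓕.mgf_law θ)]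
  have hb : HasDerivAt 𝓕.b (deriv 𝓕.b θ) (θ + 0 * 𝓕.φ) := by
    rw [zero_mul, add_zero]
    exact (𝓕.contDiff_b.differentiable (by norm_num) θ).hasDerivAt
  have hl : HasDerivAt (fun s : ℝ => θ + s * 𝓕.φ) 𝓕.φ 0 := by
    simpa using ((hasDerivAt_id (0 : ℝ)).mul_const 𝓕.φ).const_add θ
  have := (((hb.comp (0 : ℝ) hl).sub_const (𝓕.b θ)).div_const 𝓕.φ).exp
  refine this.deriv.trans ?_
  simp [hφ.ne']

end ExpFamily

/-! ### Sub-exponential random variables -/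

/-- Compare the power series term by term: both start at degree two, where `|q| ^ (n + 2) ≤ q ^ 2`.
-/
theorem exp_mul_sub_le {q : ℝ} (hq : |q| ≤ 1) (z : ℝ) :
    Real.exp (q * z) - 1 - q * z ≤ q ^ 2 * (Real.exp |z| - 1 - |z|) := by
  have hs : ∀ x : ℝ, HasSum (fun n : ℕ => x ^ (n + 2) / (n + 2).factorial) (Real.exp x - 1 - x) := by
    intro x
    have h := NormedSpace.expSeries_div_hasSum_exp x
    rw [← Real.exp_eq_exp_ℝ] at h
    have := (hasSum_nat_add_iff' 2).2 h
    simpa [Finset.sum_range_succ, sub_sub] using this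
  refine hasSum_le (fun n => ?_) (hs (q * z)) ((hs |z|).mul_left (q ^ 2))
  rw [← mul_div_assoc]
  gcongr
  calc (q * z) ^ (n + 2) ≤ |(q * z) ^ (n + 2)| := le_abs_self _
    _ = |q| ^ n * (q ^ 2 * |z| ^ (n + 2)) := by
      rw [mul_pow, abs_mul, abs_pow, abs_pow, pow_add |q|, sq_abs]; ring
    _ ≤ 1 * (q ^ 2 * |z| ^ (n + 2)) := by
      gcongr
      exact pow_le_one₀ (abs_nonneg _) hq
    _ = _ := one_mul _

section SubExponential

variable {Ω : Type*} [MeasurableSpace Ω] {μ : Measure Ω} {e : Ω → ℝ} {M v : ℝ}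

theorem integrable_of_lintegral_exp_abs_le (he : Measurable e)
    (hmom : ∫⁻ ω, ENNReal.ofReal ((Real.exp (|e ω| / M) - 1 - |e ω| / M) * M ^ 2) ∂μ
      ≤ ENNReal.ofReal (v / 2)) :
    Integrable (fun ω => (Real.exp (|e ω| / M) - 1 - |e ω| / M) * M ^ 2) μ := by
  refine ⟨by fun_prop, ?_⟩
  rw [hasFiniteIntegral_iff_ofReal (ae_of_all _ fun ω => ?_)]
  · exact hmom.trans_lt ENNReal.ofReal_lt_top
  · have := Real.add_one_le_exp (|e ω| / M)
    exact mul_nonneg (by linarith) (sq_nonneg M)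

theorem integral_exp_abs_le (hv : 0 < v) (he : Measurable e)
    (hmom : ∫⁻ ω, ENNReal.ofReal ((Real.exp (|e ω| / M) - 1 - |e ω| / M) * M ^ 2) ∂μ
      ≤ ENNReal.ofReal (v / 2)) :
    ∫ ω, (Real.exp (|e ω| / M) - 1 - |e ω| / M) * M ^ 2 ∂μ ≤ v / 2 := by
  rw [integral_eq_lintegral_of_nonneg_ae (ae_of_all _ fun ω => ?_) (by fun_prop)]
  · exact ENNReal.toReal_le_of_le_ofReal (by positivity) hmom
  · have := Real.add_one_le_exp (|e ω| / M)
    exact mul_nonneg (by linarith) (sq_nonneg M)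

theorem sq_le_of_exp_abs (hM : 0 < M) (z : ℝ) :
    z ^ 2 ≤ 2 * ((Real.exp (|z| / M) - 1 - |z| / M) * M ^ 2) := by
  have h := Real.quadratic_le_exp_of_nonneg (x := |z| / M) (by positivity)
  have h2 : z ^ 2 = (|z| / M) ^ 2 * M ^ 2 := by
    rw [← mul_pow, div_mul_cancel₀ _ hM.ne', sq_abs]
  rw [h2]
  nlinarith [sq_nonneg M]

theorem memLp_two_of_exp_abs (hM : 0 < M) (he : Measurable e)
    (hmom : ∫⁻ ω, ENNReal.ofReal ((Real.exp (|e ω| / M) - 1 - |e ω| / M) * M ^ 2) ∂μ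
      ≤ ENNReal.ofReal (v / 2)) : MemLp e 2 μ := by
  rw [memLp_two_iff_integrable_sq he.aestronglyMeasurable]
  refine ((integrable_of_lintegral_exp_abs_le he hmom).const_mul 2).mono' (by fun_prop)
    (ae_of_all _ fun ω => ?_)
  rw [Real.norm_of_nonneg (sq_nonneg _)]
  exact sq_le_of_exp_abs hM _

theorem integral_sq_le_of_exp_abs (hM : 0 < M) (hv : 0 < v) (he : Measurable e)
    (hmom : ∫⁻ ω, ENNReal.ofReal ((Real.exp (|e ω| / M) - 1 - |e ω| / M) * M ^ 2) ∂μ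
      ≤ ENNReal.ofReal (v / 2)) : ∫ ω, e ω ^ 2 ∂μ ≤ v := by
  have h1 := integral_mono (memLp_two_of_exp_abs hM he hmom).integrable_sq
    ((integrable_of_lintegral_exp_abs_le he hmom).const_mul 2)
    (fun ω => sq_le_of_exp_abs hM (e ω))
  rw [integral_const_mul] at h1
  linarith [integral_exp_abs_le hv he hmom]

variable [IsProbabilityMeasure μ]

/-- Apply `exp_mul_sub_le` with `q = t M` and `z = e / M`. The linear term has mean zero, the
remainder has mean at most `t² v / 2`, and `1 + x ≤ exp x` finishes. -/
theorem integrable_exp_mul_and_mgf_le (hM : 0 < M) (hv : 0 < v) (he : Measurable e)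
    (hmom : ∫⁻ ω, ENNReal.ofReal ((Real.exp (|e ω| / M) - 1 - |e ω| / M) * M ^ 2) ∂μ
      ≤ ENNReal.ofReal (v / 2)) (hmean : ∫ ω, e ω ∂μ = 0) {t : ℝ} (ht : |t| * M ≤ 1) :
    Integrable (fun ω => Real.exp (t * e ω)) μ ∧ mgf e μ t ≤ Real.exp (t ^ 2 * v / 2) := by
  have hI := (integrable_of_lintegral_exp_abs_le he hmom).const_mul (t ^ 2)
  have hei : Integrable e μ := (memLp_two_of_exp_abs hM he hmom).integrable (by norm_num)
  have hF : Integrable (fun ω => 1 + t * e ω) μ := (integrable_const 1).add (hei.const_mul t)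
  have hE : Integrable (fun ω => 1 + t * e ω +
      t ^ 2 * ((Real.exp (|e ω| / M) - 1 - |e ω| / M) * M ^ 2)) μ := hF.add hI
  have hle : ∀ ω, Real.exp (t * e ω) ≤ 1 + t * e ω +
      t ^ 2 * ((Real.exp (|e ω| / M) - 1 - |e ω| / M) * M ^ 2) := by
    intro ω
    have h := exp_mul_sub_le (q := t * M) (by rwa [abs_mul, abs_of_pos hM]) (e ω / M)
    rw [abs_div, abs_of_pos hM] at h
    have h2 : t * M * (e ω / M) = t * e ω := by field_simp
    rw [h2] at h
    linarith
  have hint : Integrable (fun ω => Real.exp (t * e ω)) μ := by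
    refine hE.mono' (by fun_prop) (ae_of_all _ fun ω => ?_)
    rw [Real.norm_of_nonneg (Real.exp_pos _).le]
    exact hle ω
  refine ⟨hint, ?_⟩
  have h1 := integral_mono hint hE hle
  rw [integral_add hF hI,
    integral_add (integrable_const 1) (hei.const_mul t), integral_const_mul, integral_const_mul,
    hmean] at h1
  simp only [integral_const, probReal_univ, smul_eq_mul, mul_one, mul_zero, add_zero] at h1
  have h2 := integral_exp_abs_le hv he hmom
  have h3 := Real.add_one_le_exp (t ^ 2 * v / 2)
  unfold mgf
  nlinarith [sq_nonneg t]

end SubExponential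

section Sums

variable {Ω : Type*} [MeasurableSpace Ω] {μ : Measure Ω} [IsProbabilityMeasure μ]
  {n : ℕ} {e : Fin n → Ω → ℝ} {M v : ℝ}

/-- Upper tail bound for a weighted sum of independent centred sub-exponential variables. -/
theorem measure_weighted_sum_ge_le (hM : 0 < M) (hv : 0 < v) (he : ∀ i, Measurable (e i))
    (hind : iIndepFun e μ)
    (hmom : ∀ i, ∫⁻ ω, ENNReal.ofReal ((Real.exp (|e i ω| / M) - 1 - |e i ω| / M) * M ^ 2) ∂μ
      ≤ ENNReal.ofReal (v / 2)) (hmean : ∀ i, ∫ ω, e i ω ∂μ = 0)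
    (x : Fin n → ℝ) {W : ℝ} (hW : ∑ i, x i ^ 2 ≤ W) {t : ℝ} (ht : 0 ≤ t)
    (htx : ∀ i, t * |x i| * M ≤ 1) (u : ℝ) :
    μ {ω | u ≤ ∑ i, x i * e i ω} ≤ ENNReal.ofReal (Real.exp (-t * u + t ^ 2 * W * v / 2)) := by
  have hm : ∀ i, Measurable fun ω => x i * e i ω := fun i => (he i).const_mul _
  have hind' : iIndepFun (fun i ω => x i * e i ω) μ :=
    hind.comp (fun i z => x i * z) fun i => measurable_const_mul _
  have hone : ∀ i, Integrable (fun ω => Real.exp (t * x i * e i ω)) μ ∧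
      mgf (e i) μ (t * x i) ≤ Real.exp ((t * x i) ^ 2 * v / 2) := fun i =>
    integrable_exp_mul_and_mgf_le hM hv (he i) (hmom i) (hmean i)
      (by rw [abs_mul, abs_of_nonneg ht]; exact htx i)
  have hint : Integrable (fun ω => Real.exp (t * (∑ i, fun ω => x i * e i ω) ω)) μ :=
    hind'.integrable_exp_mul_sum hm fun i _ => by
      simpa only [mul_assoc] using (hone i).1
  have hmgf : mgf (∑ i, fun ω => x i * e i ω) μ t ≤ Real.exp (t ^ 2 * W * v / 2) := by
    rw [hind'.mgf_sum hm Finset.univ]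
    calc ∏ i, mgf (fun ω => x i * e i ω) μ t
        ≤ ∏ i, Real.exp ((t * x i) ^ 2 * v / 2) := by
          refine Finset.prod_le_prod (fun i _ => mgf_nonneg) fun i _ => ?_
          have h := (hone i).2
          unfold mgf at h ⊢
          simpa only [mul_assoc] using h
      _ = Real.exp (t ^ 2 * (∑ i, x i ^ 2) * v / 2) := by
          rw [← Real.exp_sum]
          congr 1
          rw [Finset.mul_sum, Finset.sum_mul, Finset.sum_div]
          exact Finset.sum_congr rfl fun i _ => by ring
      _ ≤ _ := by gcongr
  have h := measure_ge_le_exp_mul_mgf (μ := μ) (X := ∑ i, fun ω => x i * e i ω) u ht hint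
  have h2 : μ.real {ω | u ≤ ∑ i, x i * e i ω} ≤ Real.exp (-t * u + t ^ 2 * W * v / 2) := by
    rw [Real.exp_add]
    simp only [Finset.sum_apply] at h
    exact h.trans (by gcongr)
  rw [Measure.real] at h2
  exact (ENNReal.le_ofReal_iff_toReal_le (measure_ne_top _ _) (Real.exp_pos _).le).2 h2

/-- Two-sided tail bound for a weighted sum of independent centred sub-exponential variables. -/
theorem measure_abs_weighted_sum_ge_le (hM : 0 < M) (hv : 0 < v) (he : ∀ i, Measurable (e i))
    (hind : iIndepFun e μ)
    (hmom : ∀ i, ∫⁻ ω, ENNReal.ofReal ((Real.exp (|e i ω| / M) - 1 - |e i ω| / M) * M ^ 2) ∂μ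
      ≤ ENNReal.ofReal (v / 2)) (hmean : ∀ i, ∫ ω, e i ω ∂μ = 0)
    (x : Fin n → ℝ) {W : ℝ} (hW : ∑ i, x i ^ 2 ≤ W) {t : ℝ} (ht : 0 ≤ t)
    (htx : ∀ i, t * |x i| * M ≤ 1) (u : ℝ) :
    μ {ω | u ≤ |∑ i, x i * e i ω|}
      ≤ 2 * ENNReal.ofReal (Real.exp (-t * u + t ^ 2 * W * v / 2)) := by
  have h1 := measure_weighted_sum_ge_le hM hv he hind hmom hmean x hW ht htx u
  have h2 := measure_weighted_sum_ge_le hM hv he hind hmom hmean (fun i => -x i) (W := W)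
    (by simpa using hW) ht (by simpa using htx) u
  rw [two_mul]
  refine (measure_mono fun ω hω => ?_).trans
    ((measure_union_le _ _).trans (add_le_add h1 h2))
  rcases le_abs.1 (show u ≤ |∑ i, x i * e i ω| from hω) with h | h
  · exact Or.inl h
  · refine Or.inr ?_
    simpa [neg_mul, Finset.sum_neg_distrib] using h

theorem integral_weighted_sum_sq_le (hM : 0 < M) (hv : 0 < v) (he : ∀ i, Measurable (e i))
    (hind : iIndepFun e μ)
    (hmom : ∀ i, ∫⁻ ω, ENNReal.ofReal ((Real.exp (|e i ω| / M) - 1 - |e i ω| / M) * M ^ 2) ∂μ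
      ≤ ENNReal.ofReal (v / 2)) (hmean : ∀ i, ∫ ω, e i ω ∂μ = 0) (x : Fin n → ℝ) :
    Integrable (fun ω => (∑ i, x i * e i ω) ^ 2) μ ∧
    ∫ ω, (∑ i, x i * e i ω) ^ 2 ∂μ ≤ (∑ i, x i ^ 2) * v := by
  have hL : ∀ i, MemLp (e i) 2 μ := fun i => memLp_two_of_exp_abs hM (he i) (hmom i)
  have hL' : ∀ i, MemLp (fun ω => x i * e i ω) 2 μ := fun i => (hL i).const_mul _
  have hind' : iIndepFun (fun i ω => x i * e i ω) μ :=
    hind.comp (fun i z => x i * z) fun i => measurable_const_mul _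
  have hS : MemLp (∑ i, fun ω => x i * e i ω) 2 μ := memLp_finsetSum' _ fun i _ => hL' i
  have hm0 : ∀ i, ∫ ω, x i * e i ω ∂μ = 0 := fun i => by
    rw [integral_const_mul, hmean, mul_zero]
  have hSm : μ[∑ i, fun ω => x i * e i ω] = 0 := by
    simp only [Finset.sum_apply]
    rw [integral_finsetSum _ fun i _ => (hL' i).integrable (by norm_num)]
    exact Finset.sum_eq_zero fun i _ => hm0 i
  have hvar := IndepFun.variance_sum (s := Finset.univ) (fun i _ => hL' i)
    fun i _ j _ hij => hind'.indepFun hij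
  rw [variance_of_integral_eq_zero hS.aestronglyMeasurable.aemeasurable hSm] at hvar
  simp only [Finset.sum_apply] at hvar
  refine ⟨by simpa using hS.integrable_sq, hvar.le.trans ?_⟩
  rw [Finset.sum_mul]
  refine Finset.sum_le_sum fun i _ => ?_
  rw [variance_of_integral_eq_zero (hL' i).aestronglyMeasurable.aemeasurable (hm0 i)]
  simp only [mul_pow]
  rw [integral_const_mul]
  gcongr
  exact integral_sq_le_of_exp_abs hM hv (he i) (hmom i)

end Sums

/-! ### Second order Taylor expansion and self-concordance -/

/-- Rolle's theorem twice: `k` is chosen so that `f t - f 0 - f' 0 t - k t²` vanishes at both `0`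
and `1`, and its derivative vanishes at `0` as well. -/
theorem exists_taylor_two {f f' f'' : ℝ → ℝ} (hf : ∀ t, HasDerivAt f (f' t) t)
    (hf' : ∀ t, HasDerivAt f' (f'' t) t) :
    ∃ ξ ∈ Set.Ioo (0 : ℝ) 1, f 1 = f 0 + f' 0 + f'' ξ / 2 := by
  set k := f 1 - f 0 - f' 0 with hk
  have h1 : ∀ t, HasDerivAt (fun t => f t - f 0 - f' 0 * t - k * t ^ 2)
      (f' t - f' 0 - 2 * k * t) t := fun t =>
    ((((hf t).sub_const (f 0)).sub ((hasDerivAt_id t).const_mul (f' 0))).sub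
      ((hasDerivAt_pow 2 t).const_mul k)).congr_deriv (by simp; ring)
  have h2 : ∀ t, HasDerivAt (fun t => f' t - f' 0 - 2 * k * t) (f'' t - 2 * k) t := fun t =>
    (((hf' t).sub_const (f' 0)).sub ((hasDerivAt_id t).const_mul (2 * k))).congr_deriv (by simp)
  obtain ⟨c, hc, hc0⟩ := exists_hasDerivAt_eq_zero (zero_lt_one' ℝ)
    (fun t _ => (h1 t).continuousAt.continuousWithinAt) (by simp [hk]) fun t _ => h1 t
  obtain ⟨d, hd, hd0⟩ := exists_hasDerivAt_eq_zero hc.1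
    (fun t _ => (h2 t).continuousAt.continuousWithinAt) (by simpa using hc0.symm)
    fun t _ => h2 t
  exact ⟨d, ⟨hd.1, hd.2.trans hc.2⟩, by linarith⟩

section Cumulant

variable {b : ℝ → ℝ} {K : ℝ}

theorem hasDerivAt_of_contDiff (hb : ContDiff ℝ 3 b) (x : ℝ) : HasDerivAt b (deriv b x) x :=
  (hb.differentiable (by norm_num) x).hasDerivAt

theorem hasDerivAt_deriv_of_contDiff (hb : ContDiff ℝ 3 b) (x : ℝ) :
    HasDerivAt (deriv b) (iteratedDeriv 2 b x) x := by
  have h := (hb.differentiable_iteratedDeriv 1 (by norm_num) x).hasDerivAt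
  rwa [← iteratedDeriv_succ, iteratedDeriv_one] at h

theorem hasDerivAt_iteratedDeriv_two_of_contDiff (hb : ContDiff ℝ 3 b) (x : ℝ) :
    HasDerivAt (iteratedDeriv 2 b) (iteratedDeriv 3 b x) x := by
  have h := (hb.differentiable_iteratedDeriv 2 (by norm_num) x).hasDerivAt
  rwa [← iteratedDeriv_succ] at h

/-- The Bregman divergence of `b`. -/
theorem exists_bregman_eq (hb : ContDiff ℝ 3 b) (x h : ℝ) :
    ∃ ξ ∈ Set.Ioo (0 : ℝ) 1,
      b (x + h) - b x - deriv b x * h = iteratedDeriv 2 b (x + ξ * h) * h ^ 2 / 2 := by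
  have hl : ∀ t : ℝ, HasDerivAt (fun t => x + t * h) h t := fun t => by
    simpa using ((hasDerivAt_id t).mul_const h).const_add x
  obtain ⟨ξ, hξ, h1⟩ := exists_taylor_two (f := fun t => b (x + t * h))
    (f' := fun t => deriv b (x + t * h) * h)
    (f'' := fun t => iteratedDeriv 2 b (x + t * h) * h * h)
    (fun t => (hasDerivAt_of_contDiff hb _).comp t (hl t))
    (fun t => ((hasDerivAt_deriv_of_contDiff hb _).comp t (hl t)).mul_const h)
  refine ⟨ξ, hξ, ?_⟩
  simp only [one_mul, zero_mul, add_zero] at h1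
  rw [h1]; ring

theorem iteratedDeriv_two_nonneg (hK : 0 < K)
    (hconc : ∀ t : ℝ, |iteratedDeriv 3 b t| ≤ K * iteratedDeriv 2 b t) (t : ℝ) :
    0 ≤ iteratedDeriv 2 b t :=
  nonneg_of_mul_nonneg_right ((abs_nonneg _).trans (hconc t)) hK

theorem bregman_nonneg (hb : ContDiff ℝ 3 b) (h2 : ∀ t, 0 ≤ iteratedDeriv 2 b t) (x h : ℝ) :
    0 ≤ b (x + h) - b x - deriv b x * h := by
  obtain ⟨ξ, -, h1⟩ := exists_bregman_eq hb x h
  rw [h1]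
  have := h2 (x + ξ * h)
  positivity

/-- By `|b'''| ≤ K b''`, the function `b'' e^{Kt}` increases and `b'' e^{-Kt}` decreases. Hence
`b''` can shrink by at most the factor `e^{-K|h|} ≥ 1 - K|h|` over a step `h`. -/
theorem mul_one_sub_le_iteratedDeriv_two (hb : ContDiff ℝ 3 b)
    (hconc : ∀ t : ℝ, |iteratedDeriv 3 b t| ≤ K * iteratedDeriv 2 b t) (hK : 0 < K) (x h : ℝ) :
    iteratedDeriv 2 b x * (1 - K * |h|) ≤ iteratedDeriv 2 b (x + h) := by
  have h2 := iteratedDeriv_two_nonneg hK hconc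
  have key : iteratedDeriv 2 b x * Real.exp (-(K * |h|)) ≤ iteratedDeriv 2 b (x + h) := by
    have hE : ∀ (s t : ℝ), HasDerivAt (fun t => iteratedDeriv 2 b t * Real.exp (s * t))
        ((iteratedDeriv 3 b t + s * iteratedDeriv 2 b t) * Real.exp (s * t)) t := fun s t =>
      ((hasDerivAt_iteratedDeriv_two_of_contDiff hb t).mul
        (((hasDerivAt_id t).const_mul s).exp)).congr_deriv (by simp; ring)
    rcases le_total 0 h with hh | hh
    · have hm : Monotone fun t => iteratedDeriv 2 b t * Real.exp (K * t) :=
        monotone_of_deriv_nonneg (fun t => (hE K t).differentiableAt) fun t => by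
          rw [(hE K t).deriv]
          exact mul_nonneg (by linarith [(abs_le.1 (hconc t)).1]) (Real.exp_pos _).le
      have := hm (show x ≤ x + h by linarith)
      simp only [mul_add, Real.exp_add] at this
      rw [abs_of_nonneg hh, Real.exp_neg, ← div_eq_mul_inv, div_le_iff₀ (Real.exp_pos _)]
      nlinarith [Real.exp_pos (K * x)]
    · have hm : Antitone fun t => iteratedDeriv 2 b t * Real.exp (-K * t) :=
        antitone_of_deriv_nonpos (fun t => (hE (-K) t).differentiableAt) fun t => by
          rw [(hE (-K) t).deriv]
          exact mul_nonpos_of_nonpos_of_nonneg (by linarith [(abs_le.1 (hconc t)).2])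
            (Real.exp_pos _).le
      have := hm (show x + h ≤ x by linarith)
      simp only [mul_add, Real.exp_add] at this
      rw [abs_of_nonpos hh, Real.exp_neg, ← div_eq_mul_inv, div_le_iff₀ (Real.exp_pos _)]
      rw [neg_mul, neg_mul_comm] at this
      nlinarith [Real.exp_pos (-(K * x))]
  refine le_trans (mul_le_mul_of_nonneg_left ?_ (h2 x)) key
  linarith [Real.add_one_le_exp (-(K * |h|))]

/-- Local quadratic lower bound for the Bregman divergence of a self-concordant function. -/
theorem bregman_ge_of_selfConcordant (hb : ContDiff ℝ 3 b)
    (hconc : ∀ t : ℝ, |iteratedDeriv 3 b t| ≤ K * iteratedDeriv 2 b t) (hK : 0 < K) {x h : ℝ} (hh : K * |h| ≤ 1) :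
    iteratedDeriv 2 b x * h ^ 2 / 3 ≤ b (x + h) - b x - deriv b x * h := by
  have h2 := iteratedDeriv_two_nonneg hK hconc x
  have hl : ∀ t : ℝ, HasDerivAt (fun t => x + t * h) h t := fun t => by
    simpa using ((hasDerivAt_id t).mul_const h).const_add x
  set w := iteratedDeriv 2 b x with hw
  set q := K * |h| with hq
  -- Subtract the cubic whose second derivative is the lower bound `w h² (1 - q t)` for that of `t ↦
  -- b (x + t h)`. At `t = 1` it equals `w h² (1/2 - q/6)`, which is at least `w h² / 3` because `q
  -- ≤ 1`.
  have hg1 : ∀ t, HasDerivAt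
      (fun t => deriv b (x + t * h) * h - w * h ^ 2 * (t - q * t ^ 2 / 2))
      (iteratedDeriv 2 b (x + t * h) * h * h - w * h ^ 2 * (1 - q * t)) t := fun t =>
    (((hasDerivAt_deriv_of_contDiff hb _).comp t (hl t)).mul_const h |>.sub
      (((hasDerivAt_id t).sub (((hasDerivAt_pow 2 t).const_mul q).div_const 2)).const_mul
        (w * h ^ 2))).congr_deriv (by simp; left; ring)
  have hg0 : ∀ t, HasDerivAt
      (fun t => b (x + t * h) - w * h ^ 2 * (t ^ 2 / 2 - q * t ^ 3 / 6))
      (deriv b (x + t * h) * h - w * h ^ 2 * (t - q * t ^ 2 / 2)) t := fun t =>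
    (((hasDerivAt_of_contDiff hb _).comp t (hl t)).sub
      ((((hasDerivAt_pow 2 t).div_const 2).sub
        (((hasDerivAt_pow 3 t).const_mul q).div_const 6)).const_mul
        (w * h ^ 2))).congr_deriv (by simp; left; ring)
  obtain ⟨ξ, hξ, h1⟩ := exists_taylor_two hg0 hg1
  have h3 := mul_one_sub_le_iteratedDeriv_two hb hconc hK x (ξ * h)
  rw [abs_mul, abs_of_pos hξ.1] at h3
  have h4 : 0 ≤ iteratedDeriv 2 b (x + ξ * h) * h * h - w * h ^ 2 * (1 - q * ξ) := by
    have : w * (1 - q * ξ) ≤ iteratedDeriv 2 b (x + ξ * h) := by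
      refine le_trans (le_of_eq ?_) h3
      rw [hq]; ring
    nlinarith [sq_nonneg h]
  simp only [one_mul, zero_mul, add_zero] at h1
  have h5 : 0 ≤ w * h ^ 2 * (1 - q) := by
    have : 0 ≤ 1 - q := by linarith
    positivity
  norm_num at h1
  linarith

end Cumulant

/-! ### Euclidean norm -/

theorem abs_sum_mul_le {ι : Type*} (s : Finset ι) (u v : ι → ℝ) :
    |∑ j ∈ s, u j * v j| ≤ Real.sqrt (∑ j ∈ s, u j ^ 2) * Real.sqrt (∑ j ∈ s, v j ^ 2) := by
  rw [← Real.sqrt_mul (Finset.sum_nonneg fun _ _ => sq_nonneg _)]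
  exact Real.abs_le_sqrt (Finset.sum_mul_sq_le_sq_mul_sq s u v)

section L2

variable {ι : Type*} [Fintype ι]

theorem l2norm_eq_norm (v : ι → ℝ) : l2norm v = ‖WithLp.toLp 2 v‖ := by
  rw [EuclideanSpace.norm_eq]
  simp [l2norm]

theorem l2norm_nonneg (v : ι → ℝ) : 0 ≤ l2norm v := Real.sqrt_nonneg _

theorem l2norm_sq (v : ι → ℝ) : l2norm v ^ 2 = ∑ j, v j ^ 2 :=
  Real.sq_sqrt (Finset.sum_nonneg fun _ _ => sq_nonneg _)

theorem l2norm_zero : l2norm (0 : ι → ℝ) = 0 := by simp [l2norm]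

theorem l2norm_add_le (u v : ι → ℝ) : l2norm (u + v) ≤ l2norm u + l2norm v := by
  simp only [l2norm_eq_norm, WithLp.toLp_add]
  exact norm_add_le _ _

theorem l2norm_smul (t : ℝ) (v : ι → ℝ) : l2norm (t • v) = |t| * l2norm v := by
  simp only [l2norm_eq_norm, WithLp.toLp_smul, norm_smul, Real.norm_eq_abs]

theorem abs_le_l2norm (v : ι → ℝ) (j : ι) : |v j| ≤ l2norm v := by
  rw [l2norm, ← Real.sqrt_sq_eq_abs]
  exact Real.sqrt_le_sqrt (Finset.single_le_sum (f := fun j => v j ^ 2)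
    (fun _ _ => sq_nonneg _) (Finset.mem_univ j))

theorem sum_abs_le_sqrt_card_mul (s : Finset ι) (v : ι → ℝ) :
    ∑ j ∈ s, |v j| ≤ Real.sqrt s.card * l2norm v := by
  have h := abs_sum_mul_le s (fun _ => 1) (fun j => |v j|)
  simp only [one_mul, one_pow, Finset.sum_const, nsmul_eq_mul, mul_one, sq_abs] at h
  refine (le_abs_self _).trans (h.trans ?_)
  gcongr
  exact Real.sqrt_le_sqrt (Finset.sum_le_sum_of_subset_of_nonneg (Finset.subset_univ s)
    fun _ _ _ => sq_nonneg _)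

theorem l2norm_subtype_of_support {p : ℕ} {T : Finset (Fin p)} {u : Fin p → ℝ}
    (hu : ∀ j ∉ T, u j = 0) : l2norm (fun j : T => u j) = l2norm u := by
  unfold l2norm
  rw [Finset.sum_coe_sort T fun j => u j ^ 2]
  congr 1
  exact Finset.sum_subset (Finset.subset_univ T) fun j _ hj => by simp [hu j hj]

end L2

/-! ### Expansions of the loss and of its gradient -/

section Loss

variable {n p : ℕ} {b : ℝ → ℝ} (X : Matrix (Fin n) (Fin p) ℝ) (y : Fin n → ℝ)

theorem gradLoss_dotProduct (β u : Fin p → ℝ) :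
    ∑ j, gradLoss b X y β j * u j
      = 1 / (n : ℝ) * ∑ i, (deriv b ((X *ᵥ β) i) - y i) * (X *ᵥ u) i := by
  have h : ∀ j, gradLoss b X y β j * u j
      = 1 / (n : ℝ) * ∑ i, (deriv b ((X *ᵥ β) i) - y i) * (X i j * u j) := by
    intro j
    rw [gradLoss, Matrix.mulVec, dotProduct, neg_mul, neg_mul, mul_assoc, Finset.sum_mul,
      ← mul_neg, ← Finset.sum_neg_distrib]
    congr 1
    exact Finset.sum_congr rfl fun i _ => by simp only [Matrix.transpose_apply]; ring
  rw [Finset.sum_congr rfl fun j _ => h j, ← Finset.mul_sum, Finset.sum_comm]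
  congr 1
  refine Finset.sum_congr rfl fun i _ => ?_
  rw [← Finset.mul_sum]
  rfl

/-- The response enters the loss linearly, so the error of linearization is an average of Bregman
divergences of `b` and contains no noise. -/
theorem loss_add_eq (β u : Fin p → ℝ) :
    loss b X y (β + u) = loss b X y β + ∑ j, gradLoss b X y β j * u j
      + 1 / (n : ℝ) * ∑ i, (b ((X *ᵥ β) i + (X *ᵥ u) i) - b ((X *ᵥ β) i)
          - deriv b ((X *ᵥ β) i) * (X *ᵥ u) i) := by
  rw [gradLoss_dotProduct, loss, loss, Matrix.mulVec_add, dotProduct_add]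
  simp only [Pi.add_apply, sub_mul, Finset.sum_sub_distrib, dotProduct]
  ring

theorem loss_add_ge (hb : ContDiff ℝ 3 b) (h2 : ∀ t, 0 ≤ iteratedDeriv 2 b t)
    (β u : Fin p → ℝ) :
    loss b X y β + ∑ j, gradLoss b X y β j * u j ≤ loss b X y (β + u) := by
  rw [loss_add_eq]
  have : 0 ≤ 1 / (n : ℝ) * ∑ i, (b ((X *ᵥ β) i + (X *ᵥ u) i) - b ((X *ᵥ β) i)
          - deriv b ((X *ᵥ β) i) * (X *ᵥ u) i) :=
    mul_nonneg (by positivity) (Finset.sum_nonneg fun i _ => bregman_nonneg hb h2 _ _)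
  linarith

/-- Average the two tangent inequalities based at the intermediate point `β + t u`; the linear terms
cancel. -/
theorem loss_add_smul_le (hb : ContDiff ℝ 3 b) (h2 : ∀ t, 0 ≤ iteratedDeriv 2 b t)
    (β u : Fin p → ℝ) {t : ℝ} (ht0 : 0 ≤ t) (ht1 : t ≤ 1) :
    loss b X y (β + t • u) ≤ (1 - t) * loss b X y β + t * loss b X y (β + u) := by
  have e1 := loss_add_ge X y hb h2 (β + t • u) (-(t • u))
  have e2 := loss_add_ge X y hb h2 (β + t • u) ((1 - t) • u)
  have h1 : β + t • u + -(t • u) = β := by abel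
  have h3 : β + t • u + (1 - t) • u = β + u := by
    rw [add_assoc, ← add_smul]; simp
  rw [h1] at e1
  rw [h3] at e2
  have s1 : ∑ j, gradLoss b X y (β + t • u) j * (-(t • u)) j
      = -t * ∑ j, gradLoss b X y (β + t • u) j * u j := by
    rw [Finset.mul_sum]
    exact Finset.sum_congr rfl fun j _ => by simp; ring
  have s2 : ∑ j, gradLoss b X y (β + t • u) j * ((1 - t) • u) j
      = (1 - t) * ∑ j, gradLoss b X y (β + t • u) j * u j := by
    rw [Finset.mul_sum]
    exact Finset.sum_congr rfl fun j _ => by simp; ring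
  rw [s1] at e1
  rw [s2] at e2
  nlinarith [mul_le_mul_of_nonneg_left e1 (sub_nonneg.2 ht1), mul_le_mul_of_nonneg_left e2 ht0]

theorem exists_loss_add_eq (hb : ContDiff ℝ 3 b) (β u : Fin p → ℝ) :
    ∃ ξ ∈ Set.Ioo (0 : ℝ) 1,
      loss b X y (β + u) = loss b X y β + ∑ j, gradLoss b X y β j * u j
        + 1 / (n : ℝ) * (∑ i, iteratedDeriv 2 b ((X *ᵥ (β + ξ • u)) i) * (X *ᵥ u) i ^ 2) / 2 := by
  have hl : ∀ (i : Fin n) (t : ℝ),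
      HasDerivAt (fun t => (X *ᵥ β) i + t * (X *ᵥ u) i) ((X *ᵥ u) i) t := fun i t => by
    simpa using ((hasDerivAt_id t).mul_const ((X *ᵥ u) i)).const_add ((X *ᵥ β) i)
  obtain ⟨ξ, hξ, h⟩ := exists_taylor_two
    (f := fun t => ∑ i, b ((X *ᵥ β) i + t * (X *ᵥ u) i))
    (f' := fun t => ∑ i, deriv b ((X *ᵥ β) i + t * (X *ᵥ u) i) * (X *ᵥ u) i)
    (f'' := fun t => ∑ i, iteratedDeriv 2 b ((X *ᵥ β) i + t * (X *ᵥ u) i) * (X *ᵥ u) i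
      * (X *ᵥ u) i)
    (fun t => HasDerivAt.fun_sum fun i _ => (hasDerivAt_of_contDiff hb _).comp t (hl i t))
    (fun t => HasDerivAt.fun_sum fun i _ =>
      ((hasDerivAt_deriv_of_contDiff hb _).comp t (hl i t)).mul_const _)
  refine ⟨ξ, hξ, ?_⟩
  simp only [one_mul, zero_mul, add_zero] at h
  rw [loss_add_eq]
  simp only [Finset.sum_sub_distrib, Matrix.mulVec_add, Matrix.mulVec_smul, Pi.add_apply,
    Pi.smul_apply, smul_eq_mul]
  rw [h]
  have : ∀ i, iteratedDeriv 2 b ((X *ᵥ β) i + ξ * (X *ᵥ u) i) * (X *ᵥ u) i * (X *ᵥ u) i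
      = iteratedDeriv 2 b ((X *ᵥ β) i + ξ * (X *ᵥ u) i) * (X *ᵥ u) i ^ 2 := fun i => by ring
  simp only [this]
  ring

/-- The intermediate point depends on `j`, so the third derivative must be controlled for each
column separately, uniformly over `N0`. -/
theorem exists_gradLoss_add_eq (hb : ContDiff ℝ 3 b) (β u : Fin p → ℝ) (j : Fin p) :
    ∃ ξ ∈ Set.Ioo (0 : ℝ) 1,
      gradLoss b X y (β + u) j = gradLoss b X y β j
        + 1 / (n : ℝ) * ∑ i, X i j * iteratedDeriv 2 b ((X *ᵥ β) i) * (X *ᵥ u) i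
        + 1 / (n : ℝ) * (∑ i, X i j * iteratedDeriv 3 b ((X *ᵥ (β + ξ • u)) i)
            * (X *ᵥ u) i ^ 2) / 2 := by
  have hl : ∀ (i : Fin n) (t : ℝ),
      HasDerivAt (fun t => (X *ᵥ β) i + t * (X *ᵥ u) i) ((X *ᵥ u) i) t := fun i t => by
    simpa using ((hasDerivAt_id t).mul_const ((X *ᵥ u) i)).const_add ((X *ᵥ β) i)
  obtain ⟨ξ, hξ, h⟩ := exists_taylor_two
    (f := fun t => ∑ i, X i j * deriv b ((X *ᵥ β) i + t * (X *ᵥ u) i))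
    (f' := fun t => ∑ i, X i j * (iteratedDeriv 2 b ((X *ᵥ β) i + t * (X *ᵥ u) i) * (X *ᵥ u) i))
    (f'' := fun t => ∑ i, X i j * (iteratedDeriv 3 b ((X *ᵥ β) i + t * (X *ᵥ u) i) * (X *ᵥ u) i
      * (X *ᵥ u) i))
    (fun t => HasDerivAt.fun_sum fun i _ =>
      ((hasDerivAt_deriv_of_contDiff hb _).comp t (hl i t)).const_mul _)
    (fun t => HasDerivAt.fun_sum fun i _ =>
      (((hasDerivAt_iteratedDeriv_two_of_contDiff hb _).comp t (hl i t)).mul_const _).const_mul _)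
  refine ⟨ξ, hξ, ?_⟩
  simp only [one_mul, zero_mul, add_zero] at h
  have hg : ∀ β, gradLoss b X y β j
      = 1 / (n : ℝ) * (∑ i, X i j * deriv b ((X *ᵥ β) i) - ∑ i, X i j * y i) := by
    intro β
    rw [gradLoss, ← Finset.sum_sub_distrib, neg_mul, ← mul_neg, Matrix.mulVec, dotProduct,
      ← Finset.sum_neg_distrib]
    congr 1
    exact Finset.sum_congr rfl fun i _ => by simp only [Matrix.transpose_apply]; ring
  rw [hg, hg]
  simp only [Matrix.mulVec_add, Matrix.mulVec_smul, Pi.add_apply, Pi.smul_apply, smul_eq_mul]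
  rw [h]
  have e1 : ∀ i, X i j * (iteratedDeriv 3 b ((X *ᵥ β) i + ξ * (X *ᵥ u) i) * (X *ᵥ u) i
      * (X *ᵥ u) i) = X i j * iteratedDeriv 3 b ((X *ᵥ β) i + ξ * (X *ᵥ u) i)
        * (X *ᵥ u) i ^ 2 := fun i => by ring
  have e2 : ∀ i, X i j * (iteratedDeriv 2 b ((X *ᵥ β) i) * (X *ᵥ u) i)
      = X i j * iteratedDeriv 2 b ((X *ᵥ β) i) * (X *ᵥ u) i := fun i => by ring
  simp only [e1, e2]
  ring

end Loss

/-! ### Quadratic forms of weighted Gram matrices -/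

section Gram

variable {n p : ℕ} (X : Matrix (Fin n) (Fin p) ℝ) {T : Finset (Fin p)}

theorem weightedGram_quadForm (w : Fin n → ℝ) {u : Fin p → ℝ} (hu : ∀ j ∉ T, u j = 0) :
    (fun j : T => u j) ⬝ᵥ (weightedGram X T w *ᵥ fun j : T => u j)
      = ∑ i, w i * (X *ᵥ u) i ^ 2 := by
  have hX : X.submatrix id (fun j : T => (j : Fin p)) *ᵥ (fun j : T => u j) = X *ᵥ u := by
    funext i
    simp only [Matrix.mulVec, dotProduct, Matrix.submatrix_apply, id]
    rw [Finset.sum_coe_sort T fun j => X i j * u j]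
    exact Finset.sum_subset (Finset.subset_univ T) fun j _ hj => by simp [hu j hj]
  rw [weightedGram, ← Matrix.mulVec_mulVec, ← Matrix.mulVec_mulVec, hX, Matrix.dotProduct_mulVec,
    Matrix.vecMul_transpose, hX, dotProduct]
  exact Finset.sum_congr rfl fun i _ => by rw [Matrix.mulVec_diagonal]; ring

theorem le_sum_of_posSemidef_sub {w : Fin n → ℝ} {c : ℝ}
    (h : (weightedGram X T w - c • (1 : Matrix T T ℝ)).PosSemidef) {u : Fin p → ℝ}
    (hu : ∀ j ∉ T, u j = 0) : c * l2norm u ^ 2 ≤ ∑ i, w i * (X *ᵥ u) i ^ 2 := by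
  have h1 := h.dotProduct_mulVec_nonneg (fun j : T => u j)
  rw [star_trivial, Matrix.sub_mulVec, dotProduct_sub, weightedGram_quadForm X w hu,
    Matrix.smul_mulVec, Matrix.one_mulVec, dotProduct_smul, smul_eq_mul] at h1
  have h2 : (fun j : T => u j) ⬝ᵥ (fun j : T => u j) = l2norm u ^ 2 := by
    rw [← l2norm_subtype_of_support hu, l2norm_sq, dotProduct]
    exact Finset.sum_congr rfl fun _ _ => by ring
  rw [h2] at h1
  linarith

theorem sum_le_of_posSemidef_sub {w : Fin n → ℝ} {c : ℝ}
    (h : (c • (1 : Matrix T T ℝ) - weightedGram X T w).PosSemidef) {u : Fin p → ℝ}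
    (hu : ∀ j ∉ T, u j = 0) : ∑ i, w i * (X *ᵥ u) i ^ 2 ≤ c * l2norm u ^ 2 := by
  have h1 := h.dotProduct_mulVec_nonneg (fun j : T => u j)
  rw [star_trivial, Matrix.sub_mulVec, dotProduct_sub, weightedGram_quadForm X w hu,
    Matrix.smul_mulVec, Matrix.one_mulVec, dotProduct_smul, smul_eq_mul] at h1
  have h2 : (fun j : T => u j) ⬝ᵥ (fun j : T => u j) = l2norm u ^ 2 := by
    rw [← l2norm_subtype_of_support hu, l2norm_sq, dotProduct]
    exact Finset.sum_congr rfl fun _ _ => by ring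
  rw [h2] at h1
  linarith

/-- Cauchy-Schwarz for a weighted Gram form bounded above. -/
theorem abs_sum_weighted_mul_le {w : Fin n → ℝ} (hw : ∀ i, 0 ≤ w i) {c : ℝ}
    (h : (c • (1 : Matrix T T ℝ) - weightedGram X T w).PosSemidef) {u v : Fin p → ℝ}
    (hu : ∀ j ∉ T, u j = 0) (hv : ∀ j ∉ T, v j = 0) (hc : 0 ≤ c) :
    |∑ i, w i * (X *ᵥ u) i * (X *ᵥ v) i| ≤ c * l2norm u * l2norm v := by
  have h1 := sum_le_of_posSemidef_sub X h hu
  have h2 := sum_le_of_posSemidef_sub X h hv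
  have h3 := abs_sum_mul_le Finset.univ (fun i => Real.sqrt (w i) * (X *ᵥ u) i)
    (fun i => Real.sqrt (w i) * (X *ᵥ v) i)
  simp only [mul_pow, Real.sq_sqrt (hw _)] at h3
  have e : ∀ i, Real.sqrt (w i) * (X *ᵥ u) i * (Real.sqrt (w i) * (X *ᵥ v) i)
      = w i * (X *ᵥ u) i * (X *ᵥ v) i := fun i => by
    linear_combination ((X *ᵥ u) i * (X *ᵥ v) i) * Real.mul_self_sqrt (hw i)
  simp only [e] at h3
  refine h3.trans ((mul_le_mul (Real.sqrt_le_sqrt h1) (Real.sqrt_le_sqrt h2)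
    (Real.sqrt_nonneg _) (Real.sqrt_nonneg _)).trans (le_of_eq ?_))
  rw [Real.sqrt_mul hc, Real.sqrt_mul hc, Real.sqrt_sq (l2norm_nonneg _),
    Real.sqrt_sq (l2norm_nonneg _)]
  linear_combination (l2norm u * l2norm v) * Real.mul_self_sqrt hc

end Gram

/-! ### Membership and cardinality of the index sets -/

namespace Problem

variable {n p r : ℕ} {D : Problem n p r} {b : ℝ → ℝ} {y : Fin n → ℝ}

theorem mem_A {j : Fin p} : j ∈ D.A ↔ D.βs j ≠ 0 := by simp [A]

theorem mem_MS {j : Fin p} : j ∈ D.MS ↔ j ∈ D.M ∨ j ∈ D.A := by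
  simp only [MS, S, Finset.mem_union, Finset.mem_sdiff]
  tauto

theorem mem_S_or_notMem_MS {j : Fin p} (hj : j ∉ D.M) : j ∈ D.S ∨ j ∉ D.MS := by
  simp only [MS, Finset.mem_union]
  tauto

theorem notMem_M_of_mem_S {j : Fin p} (hj : j ∈ D.S) : j ∉ D.M := (Finset.mem_sdiff.1 hj).2

theorem notMem_M_of_notMem_MS {j : Fin p} (hj : j ∉ D.MS) : j ∉ D.M := fun h =>
  hj (mem_MS.2 (Or.inl h))

theorem βs_eq_zero_of_notMem {j : Fin p} (hj : j ∉ D.MS) : D.βs j = 0 := by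
  by_contra h
  exact hj (mem_MS.2 (Or.inr (mem_A.2 h)))

theorem card_MS : (D.MS.card : ℝ) = (D.S.card : ℝ) + D.M.card := by
  rw [MS, Finset.card_union_of_disjoint (by rw [S]; exact Finset.disjoint_sdiff), add_comm]
  push_cast
  rfl

/-! ### The LLA algorithm -/

section LLA

variable {dp : ℝ → ℝ} {F : Set (Fin p → ℝ)} {lam a a₁ a₂ : ℝ} {orc init : Fin p → ℝ}

/-- One step of the LLA algorithm finds the oracle estimator, for every starting point which gives
large weights outside `M ∪ S` and no weight to `S`. -/
theorem argmin_weighted_iff (hb : ContDiff ℝ 3 b) (h2 : ∀ t, 0 ≤ iteratedDeriv 2 b t)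
    (horc : IsUniqueArgmin (loss b D.X y) (D.oracleSpace ∩ F) orc)
    (hkkt : ∀ β ∈ F, ∑ j ∈ D.MS, gradLoss b D.X y orc j * (β j - orc j) = 0)
    {x : ℝ} (hgrad : ∀ j ∉ D.MS, |gradLoss b D.X y orc j| < x) {w : Fin p → ℝ}
    (hwS : ∀ j ∈ D.S, w j = 0) (hwN : ∀ j ∉ D.MS, x ≤ w j) (β : Fin p → ℝ) :
    IsArgmin (fun β => loss b D.X y β + ∑ j ∈ D.Mᶜ, w j * |β j|) F β ↔ β = orc := by
  have horcF : orc ∈ F := horc.1.1.2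
  have horc0 : ∀ j ∉ D.MS, orc j = 0 := horc.1.1.1
  have hpen : ∀ β : Fin p → ℝ, ∑ j ∈ D.Mᶜ, w j * |β j| = ∑ j ∈ D.MSᶜ, w j * |β j| := by
    intro β
    refine (Finset.sum_subset (fun j hj => ?_) fun j hj hj' => ?_).symm
    · exact Finset.mem_compl.2 (notMem_M_of_notMem_MS (Finset.mem_compl.1 hj))
    · rcases mem_S_or_notMem_MS (Finset.mem_compl.1 hj) with h | h
      · rw [hwS j h, zero_mul]
      · exact absurd (Finset.mem_compl.2 h) hj'
  have hpo : ∑ j ∈ D.MSᶜ, w j * |orc j| = 0 := Finset.sum_eq_zero fun j hj => by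
    rw [horc0 j (Finset.mem_compl.1 hj), abs_zero, mul_zero]
  -- Tangent inequality at the oracle: the `M ∪ S` part vanishes by `hkkt`, and outside `M ∪ S` the
  -- gradient is charged against the weights.
  have hge : ∀ β ∈ F, loss b D.X y orc + ∑ j ∈ D.MSᶜ, (w j - |gradLoss b D.X y orc j|) * |β j|
      ≤ loss b D.X y β + ∑ j ∈ D.MSᶜ, w j * |β j| := by
    intro β hβ
    have h := loss_add_ge D.X y hb h2 orc (β - orc)
    rw [add_sub_cancel, ← Finset.sum_add_sum_compl D.MS] at h
    simp only [Pi.sub_apply] at h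
    rw [hkkt β hβ, zero_add] at h
    have h3 : -∑ j ∈ D.MSᶜ, |gradLoss b D.X y orc j| * |β j|
        ≤ ∑ j ∈ D.MSᶜ, gradLoss b D.X y orc j * (β j - orc j) := by
      rw [← Finset.sum_neg_distrib]
      refine Finset.sum_le_sum fun j hj => ?_
      rw [horc0 j (Finset.mem_compl.1 hj), sub_zero, ← abs_mul]
      exact neg_abs_le _
    simp only [sub_mul, Finset.sum_sub_distrib]
    linarith
  have hterm : ∀ (β : Fin p → ℝ), ∀ j ∈ D.MSᶜ,
      0 ≤ (w j - |gradLoss b D.X y orc j|) * |β j| := fun β j hj => by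
    have := hwN j (Finset.mem_compl.1 hj)
    have := hgrad j (Finset.mem_compl.1 hj)
    exact mul_nonneg (by linarith) (abs_nonneg _)
  constructor
  · rintro ⟨hβ, hmin⟩
    have h1 := hmin orc horcF
    simp only [hpen, hpo, add_zero] at h1
    have h3 := hge β hβ
    have h4 : ∑ j ∈ D.MSᶜ, (w j - |gradLoss b D.X y orc j|) * |β j| = 0 :=
      le_antisymm (by linarith) (Finset.sum_nonneg (hterm β))
    rw [Finset.sum_eq_zero_iff_of_nonneg (hterm β)] at h4
    have h5 : ∀ j ∉ D.MS, β j = 0 := by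
      intro j hj
      rcases mul_eq_zero.1 (h4 j (Finset.mem_compl.2 hj)) with h | h
      · linarith [hwN j hj, hgrad j hj]
      · exact abs_eq_zero.1 h
    have h6 : ∑ j ∈ D.MSᶜ, w j * |β j| = 0 := Finset.sum_eq_zero fun j hj => by
      rw [h5 j (Finset.mem_compl.1 hj), abs_zero, mul_zero]
    rw [h6, add_zero] at h1
    -- The strict gap has forced `β` into the oracle space, where its loss does not exceed that of
    -- the oracle; uniqueness there identifies the two.
    exact horc.2 β ⟨⟨h5, hβ⟩, fun z hz => h1.trans (horc.1.2 z hz)⟩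
  · rintro rfl
    refine ⟨horcF, fun z hz => ?_⟩
    simp only [hpen, hpo, add_zero]
    have := Finset.sum_nonneg (hterm z)
    linarith [hge z hz]

/-- The second hypothesis says that the oracle is a fixed point with no other choice of minimizer,
so reaching it once suffices. This also yields existence of runs of every length. -/
theorem llaConverges_of_argmin_iff
    (hinit : ∀ β, IsArgmin
      (fun β => loss b D.X y β + ∑ j ∈ D.Mᶜ, dp |init j| * |β j|) F β ↔ β = orc)
    (horc : ∀ β, IsArgmin
      (fun β => loss b D.X y β + ∑ j ∈ D.Mᶜ, dp |orc j| * |β j|) F β ↔ β = orc) :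
    D.LLAConvergesInTwoSteps b y dp F init orc := by
  intro B
  refine ⟨⟨fun k => if k = 0 then init else orc, if_pos rfl, fun k _ => ?_⟩, ?_⟩
  · by_cases hk : k = 0
    · simpa [hk] using (hinit orc).2 rfl
    · simpa [hk] using (horc orc).2 rfl
  · rintro seq ⟨h0, hs⟩ k hk1
    induction k with
    | zero => omega
    | succ k ih =>
      intro hkB
      have h := hs k (by omega)
      rcases Nat.eq_zero_or_pos k with hk | hk
      · subst hk
        rw [h0] at h
        exact (hinit _).1 h
      · rw [ih hk (by omega)] at h
        exact (horc _).1 h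

/-- The factor `min 1 a₂` serves two purposes. On `S` an error of at most `lam` leaves `|init j|`
above `a * lam`, where the weight is zero; outside `M ∪ S` an error of at most `a₂ * lam` keeps the
weight at least `a₁ * lam`. For later steps, the zeros of the oracle receive the weight `dp 0`. -/
theorem llaConvergesInTwoSteps {pen : ℝ → ℝ} (hb : ContDiff ℝ 3 b)
    (h2 : ∀ t, 0 ≤ iteratedDeriv 2 b t) (hpen : IsFoldedConcave a a₁ a₂ lam pen dp)
    (ha₂ : 0 < a₂) (hlam : 0 < lam) (hsignal : ∀ j ∈ D.S, (a + 1) * lam < |D.βs j|)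
    (horc : IsUniqueArgmin (loss b D.X y) (D.oracleSpace ∩ F) orc)
    (hkkt : ∀ β ∈ F, ∑ j ∈ D.MS, gradLoss b D.X y orc j * (β j - orc j) = 0)
    (hinit : ∀ j ∉ D.M, |init j - D.βs j| ≤ min 1 a₂ * lam)
    (hgrad : ∀ j ∉ D.MS, |gradLoss b D.X y orc j| < a₁ * lam)
    (horcS : ∀ j ∈ D.S, a * lam < |orc j|) :
    D.LLAConvergesInTwoSteps b y dp F init orc := by
  have hdp : ∀ t, 0 ≤ t → t ≤ a₂ * lam → a₁ * lam ≤ dp t := fun t ht ht' => by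
    rcases ht.eq_or_lt with h | h
    · rw [← h]; exact hpen.dp_zero_ge
    · exact hpen.dp_ge t h ht'
  refine llaConverges_of_argmin_iff (fun β => ?_) fun β => ?_
  · refine argmin_weighted_iff (w := fun j => dp |init j|) hb h2 horc hkkt hgrad
      (fun j hj => hpen.dp_eq_zero _ ?_) (fun j hj => hdp _ (abs_nonneg _) ?_) β
    · have h1 := hinit j (notMem_M_of_mem_S hj)
      have h3 : min 1 a₂ * lam ≤ 1 * lam := by gcongr; exact min_le_left _ _
      have h4 := abs_sub_abs_le_abs_sub (D.βs j) (init j)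
      rw [abs_sub_comm] at h4
      linarith [hsignal j hj]
    · have h1 := hinit j (notMem_M_of_notMem_MS hj)
      rw [βs_eq_zero_of_notMem hj, sub_zero] at h1
      exact h1.trans (by gcongr; exact min_le_right _ _)
  · refine argmin_weighted_iff (w := fun j => dp |orc j|) hb h2 horc hkkt hgrad
      (fun j hj => hpen.dp_eq_zero _ (horcS j hj).le) (fun j hj => hdp _ (abs_nonneg _) ?_) β
    rw [horc.1.1.1 j hj, abs_zero]
    positivity

end LLA

/-- On `M` the gradient lies in the row space of `C`, while the difference of two feasible vectors
lies in the kernel of `C`. -/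
theorem IsReducedOracle.sum_gradLoss_mul_sub {β : Fin p → ℝ} (h : D.IsReducedOracle b y β)
    {z : Fin p → ℝ} (hz : z ∈ D.reduced) :
    ∑ j ∈ D.MS, gradLoss b D.X y β j * (z j - β j) = 0 := by
  obtain ⟨-, ⟨η, hη, hS⟩, hC⟩ := h
  rw [MS, Finset.sum_union (by rw [S]; exact Finset.disjoint_sdiff),
    Finset.sum_eq_zero (s := D.S) fun j hj => by rw [hS j hj, zero_mul], add_zero,
    ← Finset.sum_coe_sort]
  have hz' : D.Cmul z = D.t := hz
  calc ∑ j : D.M, gradLoss b D.X y β j * (z j - β j)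
      = (D.Cᵀ *ᵥ η) ⬝ᵥ fun j : D.M => z j - β j :=
        Finset.sum_congr rfl fun j _ => by rw [hη]
    _ = η ⬝ᵥ (D.Cmul z - D.Cmul β) := by
        rw [Matrix.mulVec_transpose, ← Matrix.dotProduct_mulVec, Cmul, Cmul, ← Matrix.mulVec_sub]
        rfl
    _ = 0 := by rw [hz', hC, sub_self, dotProduct_zero]

theorem IsFullOracle.sum_gradLoss_mul_sub {β : Fin p → ℝ} (h : D.IsFullOracle b y β)
    (z : Fin p → ℝ) : ∑ j ∈ D.MS, gradLoss b D.X y β j * (z j - β j) = 0 :=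
  Finset.sum_eq_zero fun j hj => by rw [h.2 j hj, zero_mul]

/-! ### The lasso -/

section Lasso

variable {K κ l : ℝ} {β : Fin p → ℝ}

/-- With empty support the cone would be empty and no minimum could be attained. This makes `s̃` and
`s + m` positive below. -/
theorem A_nonempty_of_isRestrictedEigenvalue (hκ : D.IsRestrictedEigenvalue b κ) :
    D.A.Nonempty := by
  obtain ⟨u, ⟨hu0, hu⟩, -⟩ := hκ.1
  by_contra hA
  rw [Finset.not_nonempty_iff_eq_empty] at hA
  rw [hA, Finset.compl_empty, Finset.sum_empty, mul_zero] at hu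
  apply hu0
  funext j
  have h := (Finset.sum_eq_zero_iff_of_nonneg fun i _ => abs_nonneg _).1
    (le_antisymm hu (Finset.sum_nonneg fun i _ => abs_nonneg _)) j (Finset.mem_univ j)
  exact abs_eq_zero.1 h

theorem abs_le_maxNorm (X : Matrix (Fin n) (Fin p) ℝ) (i : Fin n) (j : Fin p) :
    |X i j| ≤ maxNorm X :=
  le_ciSup (f := fun q : Fin n × Fin p => |X q.1 q.2|) (Set.finite_range _).bddAbove (i, j)

theorem abs_mulVec_le_maxNorm (X : Matrix (Fin n) (Fin p) ℝ) (u : Fin p → ℝ) (i : Fin n) :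
    |(X *ᵥ u) i| ≤ maxNorm X * ∑ j, |u j| := by
  rw [Matrix.mulVec, dotProduct, Finset.mul_sum]
  refine (Finset.abs_sum_le_sum_abs _ _).trans (Finset.sum_le_sum fun j _ => ?_)
  rw [abs_mul]
  gcongr
  exact abs_le_maxNorm X i j

theorem hessLoss_quadForm (X : Matrix (Fin n) (Fin p) ℝ) (β u : Fin p → ℝ) :
    u ⬝ᵥ (hessLoss b X β *ᵥ u)
      = 1 / (n : ℝ) * ∑ i, iteratedDeriv 2 b ((X *ᵥ β) i) * (X *ᵥ u) i ^ 2 := by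
  rw [hessLoss, Matrix.smul_mulVec, dotProduct_smul, smul_eq_mul, ← Matrix.mulVec_mulVec,
    ← Matrix.mulVec_mulVec, Matrix.dotProduct_mulVec, Matrix.vecMul_transpose, dotProduct]
  congr 1
  exact Finset.sum_congr rfl fun i _ => by rw [Matrix.mulVec_diagonal]; ring

theorem IsRestrictedEigenvalue.le_quadForm (hκ : D.IsRestrictedEigenvalue b κ)
    {u : Fin p → ℝ} (hu : u ∈ D.cone) :
    κ * l2norm u ^ 2
      ≤ 1 / (n : ℝ) * ∑ i, iteratedDeriv 2 b ((D.X *ᵥ D.βs) i) * (D.X *ᵥ u) i ^ 2 := by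
  have h := hκ.2 ⟨u, hu, rfl⟩
  have huu : u ⬝ᵥ u = l2norm u ^ 2 := by
    rw [l2norm_sq, dotProduct]
    exact Finset.sum_congr rfl fun _ _ => by ring
  have hpos : 0 < u ⬝ᵥ u := by
    refine lt_of_le_of_ne (by rw [huu]; positivity) fun h0 => hu.1 (dotProduct_self_eq_zero.1 h0.symm)
  rw [le_div_iff₀ hpos, hessLoss_quadForm, huu] at h
  exact h

/-- The change of the `ℓ₁`-norm under a perturbation of the true vector. -/
theorem sum_abs_add_ge (u : Fin p → ℝ) :
    ∑ j, |D.βs j| + ∑ j ∈ D.Aᶜ, |u j| - ∑ j ∈ D.A, |u j| ≤ ∑ j, |(D.βs + u) j| := by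
  rw [← Finset.sum_add_sum_compl D.A fun j => |D.βs j|,
    ← Finset.sum_add_sum_compl D.A fun j => |(D.βs + u) j|]
  have h1 : ∑ j ∈ D.Aᶜ, |D.βs j| = 0 := Finset.sum_eq_zero fun j hj => by
    have := Finset.mem_compl.1 hj
    rw [mem_A, not_not] at this
    rw [this, abs_zero]
  have h2 : ∑ j ∈ D.Aᶜ, |(D.βs + u) j| = ∑ j ∈ D.Aᶜ, |u j| := Finset.sum_congr rfl fun j hj => by
    have := Finset.mem_compl.1 hj
    rw [mem_A, not_not] at this
    rw [Pi.add_apply, this, zero_add]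
  have h3 : ∑ j ∈ D.A, |D.βs j| - ∑ j ∈ D.A, |u j| ≤ ∑ j ∈ D.A, |(D.βs + u) j| := by
    rw [← Finset.sum_sub_distrib]
    refine Finset.sum_le_sum fun j _ => ?_
    have := abs_sub_abs_le_abs_sub (D.βs j) (-(u j))
    rwa [abs_neg, sub_neg_eq_add] at this
  linarith

/-- A perturbation which does not increase the lasso objective lies in the cone. -/
theorem cone_of_lasso_le (hb : ContDiff ℝ 3 b) (h2 : ∀ t, 0 ≤ iteratedDeriv 2 b t) (hl : 0 < l)
    (hgrad : ∀ j, |gradLoss b D.X y D.βs j| ≤ l / 2) {u : Fin p → ℝ}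
    (hle : loss b D.X y (D.βs + u) + l * ∑ j, |(D.βs + u) j|
      ≤ loss b D.X y D.βs + l * ∑ j, |D.βs j|) :
    ∑ j ∈ D.Aᶜ, |u j| ≤ 3 * ∑ j ∈ D.A, |u j| ∧
    loss b D.X y (D.βs + u) - loss b D.X y D.βs - ∑ j, gradLoss b D.X y D.βs j * u j
      ≤ 3 / 2 * l * ∑ j ∈ D.A, |u j| := by
  have h1 := loss_add_ge D.X y hb h2 D.βs u
  have h3 := mul_le_mul_of_nonneg_left (sum_abs_add_ge (D := D) u) hl.le
  have h4 : -(l / 2 * (∑ j ∈ D.A, |u j| + ∑ j ∈ D.Aᶜ, |u j|))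
      ≤ ∑ j, gradLoss b D.X y D.βs j * u j := by
    rw [Finset.sum_add_sum_compl, Finset.mul_sum, ← Finset.sum_neg_distrib]
    refine Finset.sum_le_sum fun j _ => ?_
    refine le_trans (neg_le_neg ?_) (neg_abs_le _)
    rw [abs_mul]
    gcongr
    exact hgrad j
  have h5 : 0 ≤ ∑ j ∈ D.Aᶜ, |u j| := Finset.sum_nonneg fun _ _ => abs_nonneg _
  -- Together these give `0 ≤ Bregman term ≤ (3/2) l ‖u_A‖₁ - (1/2) l ‖u_{Aᶜ}‖₁`, which contains
  -- both claims.
  constructor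
  · nlinarith
  · nlinarith

/-- The `ℓ₂`-error of the lasso. -/
theorem l2norm_lasso_sub_le (hb : ContDiff ℝ 3 b) (hK : 0 < K)
    (hconc : ∀ t : ℝ, |iteratedDeriv 3 b t| ≤ K * iteratedDeriv 2 b t)
    (hκpos : 0 < κ) (hκ : D.IsRestrictedEigenvalue b κ) (hl : 0 < l)
    (hlκ : l ≤ κ / (20 * K * maxNorm D.X * D.A.card))
    (hgrad : ∀ j, |gradLoss b D.X y D.βs j| ≤ l / 2) (hβ : D.IsLasso b y l β) :
    l2norm (β - D.βs) ≤ 5 * Real.sqrt D.A.card * l / κ := by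
  have h2 := iteratedDeriv_two_nonneg hK hconc
  have hs : (0 : ℝ) < D.A.card :=
    Nat.cast_pos.2 (A_nonempty_of_isRestrictedEigenvalue hκ).card_pos
  have hss : 0 < Real.sqrt D.A.card := Real.sqrt_pos.2 hs
  set R := 5 * Real.sqrt D.A.card * l / κ with hR
  have hRpos : 0 < R := by positivity
  by_contra! hlt
  set d := β - D.βs with hd
  have hdpos : 0 < l2norm d := hRpos.trans hlt
  -- Localization: if the error exceeded `R`, shrink it to norm exactly `R`. By convexity the
  -- shrunken point still does not exceed the objective at `β*`, and it is close enough to use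
  -- self-concordance.
  set t := R / l2norm d with ht
  have ht0 : 0 < t := by positivity
  have ht1 : t ≤ 1 := (div_le_one hdpos).2 hlt.le
  have hnu : l2norm (t • d) = R := by
    rw [l2norm_smul, abs_of_pos ht0, ht, div_mul_cancel₀ _ hdpos.ne']
  have hβd : D.βs + d = β := by rw [hd]; abel
  have hconv : ∑ j, |(D.βs + t • d) j| ≤ (1 - t) * ∑ j, |D.βs j| + t * ∑ j, |β j| := by
    rw [Finset.mul_sum, Finset.mul_sum, ← Finset.sum_add_distrib]
    refine Finset.sum_le_sum fun j _ => ?_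
    have e : (D.βs + t • d) j = (1 - t) * D.βs j + t * β j := by
      simp only [hd, Pi.add_apply, Pi.smul_apply, Pi.sub_apply, smul_eq_mul]; ring
    rw [e]
    refine (abs_add_le _ _).trans (le_of_eq ?_)
    rw [abs_mul, abs_mul, abs_of_pos ht0, abs_of_nonneg (sub_nonneg.2 ht1)]
  have hle : loss b D.X y (D.βs + t • d) + l * ∑ j, |(D.βs + t • d) j|
      ≤ loss b D.X y D.βs + l * ∑ j, |D.βs j| := by
    have e1 := loss_add_smul_le D.X y hb h2 D.βs d ht0.le ht1
    rw [hβd] at e1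
    have e2 := hβ.2 D.βs (Set.mem_univ _)
    have e3 := mul_le_mul_of_nonneg_left hconv hl.le
    have e4 := mul_le_mul_of_nonneg_left e2 ht0.le
    simp only at e4
    linarith
  obtain ⟨hcone, hbreg⟩ := cone_of_lasso_le hb h2 hl hgrad hle
  set u := t • d with hu
  have hu0 : u ≠ 0 := fun h0 => by
    rw [h0, l2norm_zero] at hnu
    exact hRpos.ne hnu
  have hA1 : ∑ j ∈ D.A, |u j| ≤ Real.sqrt D.A.card * R := by
    have := sum_abs_le_sqrt_card_mul D.A u
    rwa [hnu] at this
  have hsq : Real.sqrt D.A.card * Real.sqrt D.A.card = D.A.card := Real.mul_self_sqrt hs.le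
  have hl1 : ∑ j, |u j| ≤ 20 * D.A.card * l / κ := by
    rw [← Finset.sum_add_sum_compl D.A]
    have e : 20 * D.A.card * l / κ = 4 * (Real.sqrt D.A.card * R) := by
      rw [hR]; linear_combination (-(20 * l / κ)) * hsq
    rw [e]; linarith
  have hX0 : 0 ≤ maxNorm D.X := Real.iSup_nonneg fun _ => abs_nonneg _
  -- If `X = 0`, the bound in `hlκ` is a division by zero with value `0`, contradicting `l > 0`.
  have hXpos : 0 < maxNorm D.X := by
    refine lt_of_le_of_ne hX0 fun h0 => ?_
    rw [← h0, mul_zero, zero_mul, div_zero] at hlκ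
    linarith
  -- The constant `20` in the bound on `l` is `4 · 5`: the cone costs a factor `4` in the `ℓ₁`-norm
  -- and `R` carries the factor `5`.
  have hsmall : ∀ i, K * |(D.X *ᵥ u) i| ≤ 1 := by
    intro i
    rw [le_div_iff₀ (by positivity)] at hlκ
    have e1 : K * |(D.X *ᵥ u) i| ≤ K * (maxNorm D.X * (20 * D.A.card * l / κ)) := by
      gcongr
      exact (abs_mulVec_le_maxNorm D.X u i).trans (by gcongr)
    refine e1.trans ?_
    have e2 : K * (maxNorm D.X * (20 * D.A.card * l / κ))
        = l * (20 * K * maxNorm D.X * D.A.card) / κ := by ring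
    rw [e2, div_le_one hκpos]
    exact hlκ
  have hre := hκ.le_quadForm (u := u) ⟨hu0, hcone⟩
  rw [hnu] at hre
  have hlow : κ * R ^ 2 / 3
      ≤ loss b D.X y (D.βs + u) - loss b D.X y D.βs - ∑ j, gradLoss b D.X y D.βs j * u j := by
    rw [loss_add_eq]
    have e : 1 / (n : ℝ) * ∑ i, iteratedDeriv 2 b ((D.X *ᵥ D.βs) i) * (D.X *ᵥ u) i ^ 2 / 3
        ≤ 1 / (n : ℝ) * ∑ i, (b ((D.X *ᵥ D.βs) i + (D.X *ᵥ u) i) - b ((D.X *ᵥ D.βs) i)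
          - deriv b ((D.X *ᵥ D.βs) i) * (D.X *ᵥ u) i) := by
      gcongr with i
      exact bregman_ge_of_selfConcordant hb hconc hK (hsmall i)
    rw [← Finset.sum_div, ← mul_div_assoc] at e
    linarith
  -- The choice of `R` makes the left side `(5/3) l √s̃ R`, which exceeds the right side.
  have h9 : κ * R ^ 2 / 3 ≤ 3 / 2 * l * (Real.sqrt D.A.card * R) :=
    hlow.trans (hbreg.trans (by gcongr))
  have h10 : κ * R ^ 2 = 5 * l * (Real.sqrt D.A.card * R) := by
    rw [hR]; field_simp
  have h11 : 0 < l * (Real.sqrt D.A.card * R) := by positivity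
  linarith

end Lasso

end Problem

namespace Problem

variable {n p r : ℕ} {D : Problem n p r} {b : ℝ → ℝ} {y : Fin n → ℝ}

/-! ### The oracle estimators -/

section Oracle

variable {c L L₃ T H R : ℝ} {d v : Fin p → ℝ}

theorem add_mem_N0 (hd : ∀ j ∉ D.MS, d j = 0)
    (h : l2norm d ≤ Real.sqrt (((D.S.card : ℝ) + D.M.card) * Real.log n / n)) :
    D.βs + d ∈ D.N0 := by
  refine ⟨?_, fun j hj => ?_⟩
  · have e : (fun j : D.MS => (D.βs + d) j - D.βs j) = fun j : D.MS => d j := by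
      funext j
      simp
    rw [e, l2norm_subtype_of_support hd]
    exact h
  · rw [Pi.add_apply, βs_eq_zero_of_notMem hj, hd j hj, add_zero]

/-- The extra `log n` in the radius of `N0` leaves room for any fixed multiple of `√((s+m)/n)`. -/
theorem mul_sqrt_le_radius {Q : ℝ} (hlog : Q ^ 2 ≤ Real.log n) :
    Q * Real.sqrt (((D.S.card : ℝ) + D.M.card) / n)
      ≤ Real.sqrt (((D.S.card : ℝ) + D.M.card) * Real.log n / n) := by
  have e : ((D.S.card : ℝ) + D.M.card) * Real.log n / n
      = Real.log n * (((D.S.card : ℝ) + D.M.card) / n) := by ring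
  rw [e, Real.sqrt_mul ((sq_nonneg Q).trans hlog)]
  gcongr
  exact Real.le_sqrt_of_sq_le hlog

/-- First order expansion of the gradient around the true vector. -/
theorem abs_gradLoss_add_sub_le (hn : 0 < n) (hb : ContDiff ℝ 3 b)
    (hthird : ∀ β ∈ D.N0, ∀ j : Fin p,
      ((L₃ * n) • (1 : Matrix D.MS D.MS ℝ) - weightedGram D.X D.MS (fun i =>
        |D.X i j| * |iteratedDeriv 3 b ((D.X *ᵥ β) i)|)).PosSemidef)
    (hd : ∀ j ∉ D.MS, d j = 0)
    (hdN : l2norm d ≤ Real.sqrt (((D.S.card : ℝ) + D.M.card) * Real.log n / n)) (j : Fin p) :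
    |gradLoss b D.X y (D.βs + d) j - gradLoss b D.X y D.βs j
      - 1 / (n : ℝ) * ∑ i, D.X i j * iteratedDeriv 2 b ((D.X *ᵥ D.βs) i) * (D.X *ᵥ d) i|
      ≤ L₃ * l2norm d ^ 2 / 2 := by
  obtain ⟨ξ, hξ, h⟩ := exists_gradLoss_add_eq D.X y hb D.βs d j
  have hn' : (0 : ℝ) < n := Nat.cast_pos.2 hn
  have hmem : D.βs + ξ • d ∈ D.N0 := by
    refine add_mem_N0 (fun j hj => by simp [hd j hj]) (le_trans ?_ hdN)
    rw [l2norm_smul, abs_of_pos hξ.1]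
    exact mul_le_of_le_one_left (l2norm_nonneg _) hξ.2.le
  have h1 := sum_le_of_posSemidef_sub D.X (hthird _ hmem j) hd
  rw [h]
  have e : ∀ u v w : ℝ, u + v + w - u - v = w := fun u v w => by ring
  rw [e, abs_div, abs_mul, abs_two, abs_of_pos (show 0 < 1 / (n : ℝ) by positivity)]
  refine div_le_div_of_nonneg_right ?_ zero_le_two
  rw [one_div, inv_mul_le_iff₀ hn']
  refine (Finset.abs_sum_le_sum_abs _ _).trans (le_trans (le_of_eq ?_) (h1.trans (by linarith)))
  exact Finset.sum_congr rfl fun i _ => by rw [abs_mul, abs_mul, abs_of_nonneg (sq_nonneg ((D.X *ᵥ d) i))]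

/-- Bound for the linear form given by the gradient at a point close to the true vector. -/
theorem abs_sum_gradLoss_mul_le (hn : 0 < n) (hb : ContDiff ℝ 3 b)
    (h2 : ∀ t, 0 ≤ iteratedDeriv 2 b t) (hL : 0 ≤ L) (hL₃ : 0 ≤ L₃) (hT : 0 ≤ T)
    (hthird : ∀ β ∈ D.N0, ∀ j : Fin p,
      ((L₃ * n) • (1 : Matrix D.MS D.MS ℝ) - weightedGram D.X D.MS (fun i =>
        |D.X i j| * |iteratedDeriv 3 b ((D.X *ᵥ β) i)|)).PosSemidef)
    (hmax : ((L * n) • (1 : Matrix D.MS D.MS ℝ) - weightedGram D.X D.MS (fun i =>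
      iteratedDeriv 2 b ((D.X *ᵥ D.βs) i))).PosSemidef)
    (hsmall : L₃ * H ^ 2 * ((D.S.card : ℝ) + D.M.card) ≤ Real.sqrt n)
    (hlog : H ^ 2 ≤ Real.log n)
    (hgrad : ∑ j ∈ D.MS, gradLoss b D.X y D.βs j ^ 2
      ≤ T ^ 2 * (((D.S.card : ℝ) + D.M.card) / n))
    (hd : ∀ j ∉ D.MS, d j = 0)
    (hdH : l2norm d ≤ H * Real.sqrt (((D.S.card : ℝ) + D.M.card) / n))
    (hv : ∀ j ∉ D.MS, v j = 0) :
    |∑ j, gradLoss b D.X y (D.βs + d) j * v j|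
      ≤ (T + L * H + 1) * Real.sqrt (((D.S.card : ℝ) + D.M.card) / n) * l2norm v := by
  have hn' : (0 : ℝ) < n := Nat.cast_pos.2 hn
  set N : ℝ := (D.S.card : ℝ) + D.M.card with hN
  have hN0 : 0 ≤ N := by positivity
  set ρ := Real.sqrt (N / n) with hρ
  have hρ0 : 0 ≤ ρ := Real.sqrt_nonneg _
  set lin : Fin p → ℝ := fun j =>
    1 / (n : ℝ) * ∑ i, D.X i j * iteratedDeriv 2 b ((D.X *ᵥ D.βs) i) * (D.X *ᵥ d) i with hlin
  have hv0 := l2norm_nonneg v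
  have hres : ∀ f : Fin p → ℝ, ∑ j, f j * v j = ∑ j ∈ D.MS, f j * v j := fun f =>
    (Finset.sum_subset (Finset.subset_univ D.MS) fun j _ hj => by rw [hv j hj, mul_zero]).symm
  have t1 : |∑ j, gradLoss b D.X y D.βs j * v j| ≤ T * ρ * l2norm v := by
    rw [hres]
    refine (abs_sum_mul_le _ _ _).trans ?_
    gcongr
    · refine (Real.sqrt_le_sqrt hgrad).trans (le_of_eq ?_)
      rw [Real.sqrt_mul (sq_nonneg T), Real.sqrt_sq hT]
    · exact Real.sqrt_le_sqrt (Finset.sum_le_sum_of_subset_of_nonneg (Finset.subset_univ _)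
        fun _ _ _ => sq_nonneg _)
  have t2 : |∑ j, lin j * v j| ≤ L * H * ρ * l2norm v := by
    have e : ∑ j, lin j * v j = 1 / (n : ℝ) *
        ∑ i, iteratedDeriv 2 b ((D.X *ᵥ D.βs) i) * (D.X *ᵥ d) i * (D.X *ᵥ v) i := by
      have e1 : ∀ j, lin j * v j = 1 / (n : ℝ) *
          ∑ i, iteratedDeriv 2 b ((D.X *ᵥ D.βs) i) * (D.X *ᵥ d) i * (D.X i j * v j) := by
        intro j
        rw [hlin, mul_assoc, Finset.sum_mul]
        congr 1
        exact Finset.sum_congr rfl fun i _ => by ring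
      rw [Finset.sum_congr rfl fun j _ => e1 j, ← Finset.mul_sum, Finset.sum_comm]
      congr 1
      refine Finset.sum_congr rfl fun i _ => ?_
      rw [← Finset.mul_sum]
      rfl
    rw [e, abs_mul, abs_of_pos (show 0 < 1 / (n : ℝ) by positivity), one_div,
      inv_mul_le_iff₀ hn']
    refine (abs_sum_weighted_mul_le D.X (fun i => h2 _) hmax hd hv (by positivity)).trans ?_
    calc L * n * l2norm d * l2norm v ≤ L * n * (H * ρ) * l2norm v := by gcongr
      _ = _ := by ring
  -- Each entry of the remainder is at most `L₃ H² ρ²`, and passing from `‖v‖₁` to `‖v‖₂` costs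
  -- `√N`. Since `√N ρ = N / √n`, this is where `s + m = o(√n)` enters, through `hsmall`.
  have t3 : |∑ j, (gradLoss b D.X y (D.βs + d) j - gradLoss b D.X y D.βs j - lin j) * v j|
      ≤ 1 * ρ * l2norm v := by
    rw [hres]
    have e1 : ∀ j, |gradLoss b D.X y (D.βs + d) j - gradLoss b D.X y D.βs j - lin j|
        ≤ L₃ * H ^ 2 * (ρ * ρ) := by
      intro j
      refine (abs_gradLoss_add_sub_le hn hb hthird hd
        (hdH.trans (mul_sqrt_le_radius hlog)) j).trans ?_
      have : l2norm d ^ 2 ≤ (H * ρ) ^ 2 := pow_le_pow_left₀ (l2norm_nonneg _) hdH 2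
      nlinarith [mul_nonneg hL₃ (sq_nonneg (l2norm d)), mul_le_mul_of_nonneg_left this hL₃]
    have e2 : Real.sqrt N * ρ = N / Real.sqrt n := by
      rw [hρ, Real.sqrt_div hN0, ← mul_div_assoc, Real.mul_self_sqrt hN0]
    calc |∑ j ∈ D.MS, (gradLoss b D.X y (D.βs + d) j - gradLoss b D.X y D.βs j - lin j) * v j|
        ≤ ∑ j ∈ D.MS, L₃ * H ^ 2 * (ρ * ρ) * |v j| := by
          refine (Finset.abs_sum_le_sum_abs _ _).trans (Finset.sum_le_sum fun j _ => ?_)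
          rw [abs_mul]
          gcongr
          exact e1 j
      _ ≤ L₃ * H ^ 2 * (ρ * ρ) * (Real.sqrt N * l2norm v) := by
          rw [← Finset.mul_sum]
          have := sum_abs_le_sqrt_card_mul D.MS v
          rw [card_MS] at this
          gcongr
      _ = L₃ * H ^ 2 * N / Real.sqrt n * (ρ * l2norm v) := by
          linear_combination (L₃ * H ^ 2 * ρ * l2norm v) * e2
      _ ≤ 1 * (ρ * l2norm v) := by
          gcongr
          exact (div_le_one (Real.sqrt_pos.2 hn')).2 hsmall
      _ = 1 * ρ * l2norm v := by ring
  have hsplit : ∑ j, gradLoss b D.X y (D.βs + d) j * v j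
      = ∑ j, gradLoss b D.X y D.βs j * v j + ∑ j, lin j * v j
        + ∑ j, (gradLoss b D.X y (D.βs + d) j - gradLoss b D.X y D.βs j - lin j) * v j := by
    rw [← Finset.sum_add_distrib, ← Finset.sum_add_distrib]
    exact Finset.sum_congr rfl fun j _ => by ring
  rw [hsplit]
  refine (abs_add_three _ _ _).trans ?_
  linarith

/-- Rate of convergence of a vector supported on `M ∪ S` whose loss does not exceed that of a
vector close to the true one. -/
theorem l2norm_sub_le_of_loss_le (hn : 0 < n) (hb : ContDiff ℝ 3 b)
    (h2 : ∀ t, 0 ≤ iteratedDeriv 2 b t) (hc : 0 < c) (hL : 0 ≤ L) (hL₃ : 0 ≤ L₃) (hT : 0 ≤ T)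
    (hH : 0 ≤ H) (hR : 0 ≤ R)
    (hmin : ∀ β ∈ D.N0,
      (weightedGram D.X D.MS (fun i => iteratedDeriv 2 b ((D.X *ᵥ β) i))
        - (c * n) • (1 : Matrix D.MS D.MS ℝ)).PosSemidef)
    (hthird : ∀ β ∈ D.N0, ∀ j : Fin p,
      ((L₃ * n) • (1 : Matrix D.MS D.MS ℝ) - weightedGram D.X D.MS (fun i =>
        |D.X i j| * |iteratedDeriv 3 b ((D.X *ᵥ β) i)|)).PosSemidef)
    (hmax : ((L * n) • (1 : Matrix D.MS D.MS ℝ) - weightedGram D.X D.MS (fun i =>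
      iteratedDeriv 2 b ((D.X *ᵥ D.βs) i))).PosSemidef)
    (hsmall : L₃ * H ^ 2 * ((D.S.card : ℝ) + D.M.card) ≤ Real.sqrt n)
    (hlog : (R + H) ^ 2 ≤ Real.log n) (hRT : T + L * H + 1 < c * R / 2)
    (hpos : 0 < (D.S.card : ℝ) + D.M.card)
    (hgrad : ∑ j ∈ D.MS, gradLoss b D.X y D.βs j ^ 2
      ≤ T ^ 2 * (((D.S.card : ℝ) + D.M.card) / n))
    (hd : ∀ j ∉ D.MS, d j = 0)
    (hdH : l2norm d ≤ H * Real.sqrt (((D.S.card : ℝ) + D.M.card) / n))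
    (hv : ∀ j ∉ D.MS, v j = 0)
    (hle : loss b D.X y (D.βs + v) ≤ loss b D.X y (D.βs + d)) :
    l2norm (v - d) ≤ R * Real.sqrt (((D.S.card : ℝ) + D.M.card) / n) := by
  have hn' : (0 : ℝ) < n := Nat.cast_pos.2 hn
  have hlogH : H ^ 2 ≤ Real.log n :=
    (pow_le_pow_left₀ hH (by linarith) 2).trans hlog
  have hrad := mul_sqrt_le_radius (D := D) hlog
  set ρ := Real.sqrt (((D.S.card : ℝ) + D.M.card) / n) with hρ
  have hρ0 : 0 < ρ := Real.sqrt_pos.2 (by positivity)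
  have hRpos : 0 < R := by
    have : 0 < c * R := by nlinarith [mul_nonneg hL hH]
    exact pos_of_mul_pos_right this hc.le
  by_contra! hlt
  have hdpos : 0 < l2norm (v - d) := (by positivity : 0 < R * ρ).trans hlt
  -- Same localization as for the lasso: shrink `v - d` to norm `R ρ`, which keeps the segment from
  -- `β* + d` inside `N0`, where the Hessian is bounded below.
  set t := R * ρ / l2norm (v - d) with ht
  have ht0 : 0 < t := by positivity
  have ht1 : t ≤ 1 := (div_le_one hdpos).2 hlt.le
  have hnu : l2norm (t • (v - d)) = R * ρ := by
    rw [l2norm_smul, abs_of_pos ht0, ht, div_mul_cancel₀ _ hdpos.ne']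
  have hle' : loss b D.X y (D.βs + d + t • (v - d)) ≤ loss b D.X y (D.βs + d) := by
    have e1 := loss_add_smul_le D.X y hb h2 (D.βs + d) (v - d) ht0.le ht1
    have e2 : D.βs + d + (v - d) = D.βs + v := by abel
    rw [e2] at e1
    nlinarith
  have hu : ∀ j ∉ D.MS, (t • (v - d)) j = 0 := fun j hj => by simp [hd j hj, hv j hj]
  set u := t • (v - d) with hu'
  obtain ⟨ξ, hξ, h⟩ := exists_loss_add_eq D.X y hb (D.βs + d) u
  have hmem : D.βs + d + ξ • u ∈ D.N0 := by
    rw [add_assoc]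
    refine add_mem_N0 (fun j hj => by simp [hd j hj, hu j hj])
      ((l2norm_add_le _ _).trans (le_trans ?_ hrad))
    rw [l2norm_smul, abs_of_pos hξ.1, hnu]
    have := mul_le_of_le_one_left (by positivity : 0 ≤ R * ρ) hξ.2.le
    linarith
  have h3 := le_sum_of_posSemidef_sub D.X (hmin _ hmem) hu
  have h4 := abs_sum_gradLoss_mul_le hn hb h2 hL hL₃ hT hthird hmax hsmall hlogH hgrad hd hdH hu
  rw [hnu] at h3 h4
  have h5 : c * (R * ρ) ^ 2 ≤ 1 / (n : ℝ) *
      ∑ i, iteratedDeriv 2 b ((D.X *ᵥ (D.βs + d + ξ • u)) i) * (D.X *ᵥ u) i ^ 2 := by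
    rw [one_div, le_inv_mul_iff₀ hn']
    linarith
  have h6 := (abs_le.1 h4).1
  have h7 : c * (R * ρ) ^ 2 / 2 ≤ (T + L * H + 1) * ρ * (R * ρ) := by linarith
  -- The curvature gain `c (R ρ)² / 2` beats the linear term by the choice of `R` in `hRT`.
  have h8 : (T + L * H + 1) * (ρ * (R * ρ)) < c * R / 2 * (ρ * (R * ρ)) := by gcongr
  nlinarith

/-- Bound for the gradient outside `M ∪ S`. -/
theorem abs_gradLoss_add_le (hn : 0 < n) (hb : ContDiff ℝ 3 b)
    (hthird : ∀ β ∈ D.N0, ∀ j : Fin p,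
      ((L₃ * n) • (1 : Matrix D.MS D.MS ℝ) - weightedGram D.X D.MS (fun i =>
        |D.X i j| * |iteratedDeriv 3 b ((D.X *ᵥ β) i)|)).PosSemidef)
    (hcross : ∀ j ∉ D.MS, ∑ k ∈ D.MS, |(D.Xᵀ * Matrix.diagonal (fun i =>
        iteratedDeriv 2 b ((D.X *ᵥ D.βs) i)) * D.X) j k| ≤ L * n)
    (hd : ∀ j ∉ D.MS, d j = 0)
    (hdN : l2norm d ≤ Real.sqrt (((D.S.card : ℝ) + D.M.card) * Real.log n / n))
    {j : Fin p} (hj : j ∉ D.MS) :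
    |gradLoss b D.X y (D.βs + d) j|
      ≤ |gradLoss b D.X y D.βs j| + L * l2norm d + L₃ * l2norm d ^ 2 / 2 := by
  have hn' : (0 : ℝ) < n := Nat.cast_pos.2 hn
  have h := abs_gradLoss_add_sub_le (y := y) hn hb hthird hd hdN j
  have hl : |1 / (n : ℝ) * ∑ i, D.X i j * iteratedDeriv 2 b ((D.X *ᵥ D.βs) i) * (D.X *ᵥ d) i|
      ≤ L * l2norm d := by
    rw [abs_mul, abs_of_pos (show 0 < 1 / (n : ℝ) by positivity), one_div, inv_mul_le_iff₀ hn']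
    have e : ∑ i, D.X i j * iteratedDeriv 2 b ((D.X *ᵥ D.βs) i) * (D.X *ᵥ d) i
        = ∑ k ∈ D.MS, (D.Xᵀ * Matrix.diagonal (fun i =>
          iteratedDeriv 2 b ((D.X *ᵥ D.βs) i)) * D.X) j k * d k := by
      rw [Finset.sum_subset (Finset.subset_univ D.MS) fun k _ hk => by rw [hd k hk, mul_zero]]
      have e0 : ∀ k, (D.Xᵀ * Matrix.diagonal (fun i =>
          iteratedDeriv 2 b ((D.X *ᵥ D.βs) i)) * D.X) j k * d k
          = ∑ i, D.X i j * iteratedDeriv 2 b ((D.X *ᵥ D.βs) i) * (D.X i k * d k) := fun k => by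
        rw [Matrix.mul_apply, Finset.sum_mul]
        exact Finset.sum_congr rfl fun i _ => by
          rw [Matrix.mul_diagonal, Matrix.transpose_apply]; ring
      rw [Finset.sum_congr rfl fun k _ => e0 k, Finset.sum_comm]
      refine Finset.sum_congr rfl fun i _ => ?_
      rw [← Finset.mul_sum]
      rfl
    rw [e]
    refine (Finset.abs_sum_le_sum_abs _ _).trans ?_
    calc ∑ k ∈ D.MS, |(D.Xᵀ * Matrix.diagonal (fun i =>
          iteratedDeriv 2 b ((D.X *ᵥ D.βs) i)) * D.X) j k * d k|
        ≤ ∑ k ∈ D.MS, |(D.Xᵀ * Matrix.diagonal (fun i =>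
          iteratedDeriv 2 b ((D.X *ᵥ D.βs) i)) * D.X) j k| * l2norm d :=
          Finset.sum_le_sum fun k _ => by
            rw [abs_mul]
            gcongr
            exact abs_le_l2norm d k
      _ ≤ L * n * l2norm d := by
          rw [← Finset.sum_mul]
          exact mul_le_mul_of_nonneg_right (hcross j hj) (l2norm_nonneg _)
      _ = _ := by ring
  rw [abs_le] at h hl
  have h1 := abs_le.1 (le_refl |gradLoss b D.X y D.βs j|)
  exact abs_le.2 ⟨by linarith [h.1, hl.1, h1.1], by linarith [h.2, hl.2, h1.2]⟩

/-- A vector of the reduced model close to the true vector. -/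
theorem exists_reduced_near (hrank : D.C.rank = r)
    (hC : (L • (1 : Matrix (Fin r) (Fin r) ℝ) - (D.C * D.Cᵀ)⁻¹).PosSemidef) :
    ∃ d : Fin p → ℝ, (∀ j ∉ D.MS, d j = 0) ∧ D.βs + d ∈ D.reduced ∧
      l2norm d ^ 2 ≤ L * l2norm D.h ^ 2 := by
  set G := D.C * D.Cᵀ with hG
  have hGu : IsUnit G := by
    have hGr : G.rank = r := by rw [hG, Matrix.rank_self_mul_transpose, hrank]
    rw [← Matrix.mulVec_surjective_iff_isUnit]
    have htop : LinearMap.range G.mulVecLin = ⊤ :=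
      Submodule.eq_top_of_finrank_eq (by rw [← Matrix.rank, hGr, Module.finrank_fin_fun])
    exact LinearMap.range_eq_top.1 htop
  have hGi : G * G⁻¹ = 1 := Matrix.mul_nonsing_inv _ ((Matrix.isUnit_iff_isUnit_det _).1 hGu)
  set z : Fin r → ℝ := G⁻¹ *ᵥ D.h with hz
  have hGz : G *ᵥ z = D.h := by rw [hz, Matrix.mulVec_mulVec, hGi, Matrix.one_mulVec]
  -- The least norm correction `-C'(CC')⁻¹ h` restores the constraint, and its squared norm is
  -- `h'(CC')⁻¹ h`.
  refine ⟨fun j => if hj : j ∈ D.M then -(D.Cᵀ *ᵥ z) ⟨j, hj⟩ else 0, fun j hj => ?_, ?_, ?_⟩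
  · exact dif_neg (notMem_M_of_notMem_MS hj)
  · have e : (fun j : D.M => (D.βs + fun j => if hj : j ∈ D.M then -(D.Cᵀ *ᵥ z) ⟨j, hj⟩ else 0) j)
        = (fun j : D.M => D.βs j) - D.Cᵀ *ᵥ z := by
      funext j
      simp [sub_eq_add_neg]
    show D.C *ᵥ _ = D.t
    rw [e, Matrix.mulVec_sub, Matrix.mulVec_mulVec, ← hG, hGz, h, Cmul, sub_sub_cancel]
  · have e1 : l2norm (fun j => if hj : j ∈ D.M then -(D.Cᵀ *ᵥ z) ⟨j, hj⟩ else 0) ^ 2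
        = (D.Cᵀ *ᵥ z) ⬝ᵥ (D.Cᵀ *ᵥ z) := by
      rw [← l2norm_subtype_of_support (T := D.M) fun j hj => dif_neg hj, l2norm_sq, dotProduct]
      exact Finset.sum_congr rfl fun j _ => by simp; ring
    have e2 : (D.Cᵀ *ᵥ z) ⬝ᵥ (D.Cᵀ *ᵥ z) = D.h ⬝ᵥ (G⁻¹ *ᵥ D.h) := by
      rw [Matrix.dotProduct_mulVec, Matrix.vecMul_transpose, Matrix.mulVec_mulVec, ← hG, hGz]
    have h1 := hC.dotProduct_mulVec_nonneg D.h
    rw [star_trivial, Matrix.sub_mulVec, dotProduct_sub, Matrix.smul_mulVec, Matrix.one_mulVec,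
      dotProduct_smul, smul_eq_mul] at h1
    have e3 : D.h ⬝ᵥ D.h = l2norm D.h ^ 2 := by
      rw [l2norm_sq, dotProduct]
      exact Finset.sum_congr rfl fun _ _ => by ring
    rw [e1, e2, ← e3]
    linarith

end Oracle

end Problem

/-! ### The gradient of the loss at the true vector -/

section GradientAtTruth

variable {n p r : ℕ} {D : Problem n p r} {Ω : Type*} {Y : Fin n → Ω → ℝ}

/-- The noise `e_i = y_i - b'(x_i' β*)`. -/
noncomputable def noise (D : Problem n p r) (b : ℝ → ℝ) (Y : Fin n → Ω → ℝ) (i : Fin n) (ω : Ω) : ℝ :=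
  Y i ω - deriv b ((D.X *ᵥ D.βs) i)

theorem gradLoss_truth (b : ℝ → ℝ) (ω : Ω) (j : Fin p) :
    gradLoss b D.X (fun i => Y i ω) D.βs j
      = -(1 / (n : ℝ)) * ∑ i, D.X i j * noise D b Y i ω := rfl

variable [MeasurableSpace Ω] {P : Measure Ω}

theorem measurable_noise {b : ℝ → ℝ} (hY : ∀ i, Measurable (Y i)) (i : Fin n) :
    Measurable (noise D b Y i) := (hY i).sub_const _

theorem iIndepFun_noise {b : ℝ → ℝ} (hind : iIndepFun Y P) : iIndepFun (noise D b Y) P :=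
  hind.comp (fun i z => z - deriv b ((D.X *ᵥ D.βs) i)) fun _ => measurable_sub_const _

variable [IsProbabilityMeasure P] {𝓕 : ExpFamily} {M v : ℝ}

theorem integral_noise (hY : ∀ i, Measurable (Y i))
    (hlaw : ∀ i, P.map (Y i) = 𝓕.law ((D.X *ᵥ D.βs) i)) (hM : 0 < M)
    (hmom : ∀ i, ∫⁻ ω, ENNReal.ofReal ((Real.exp (|noise D 𝓕.b Y i ω| / M) - 1
      - |noise D 𝓕.b Y i ω| / M) * M ^ 2) ∂P ≤ ENNReal.ofReal (v / 2)) (i : Fin n) :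
    ∫ ω, noise D 𝓕.b Y i ω ∂P = 0 := by
  have hi : Integrable (noise D 𝓕.b Y i) P :=
    (memLp_two_of_exp_abs hM (measurable_noise hY i) (hmom i)).integrable (by norm_num)
  have hYi : Integrable (Y i) P :=
    (hi.add (integrable_const (deriv 𝓕.b ((D.X *ᵥ D.βs) i)))).congr
      (ae_of_all _ fun ω => by simp [noise])
  have h : ∫ ω, Y i ω ∂P = deriv 𝓕.b ((D.X *ᵥ D.βs) i) := by
    rw [← 𝓕.integral_law, ← hlaw i, integral_map (hY i).aemeasurable (by fun_prop)]
  simp only [noise]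
  rw [integral_sub hYi (integrable_const _), h]
  simp

/-- The gradient at the true vector is uniformly small with high probability. -/
theorem measure_gradLoss_truth_gt_le (hn : 0 < n) (hp : 2 ≤ p) (hY : ∀ i, Measurable (Y i))
    (hind : iIndepFun Y P)
    (hlaw : ∀ i, P.map (Y i) = 𝓕.law ((D.X *ᵥ D.βs) i)) (hM : 0 < M) (hv : 0 < v)
    (hmom : ∀ i, ∫⁻ ω, ENNReal.ofReal ((Real.exp (|noise D 𝓕.b Y i ω| / M) - 1
      - |noise D 𝓕.b Y i ω| / M) * M ^ 2) ∂P ≤ ENNReal.ofReal (v / 2))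
    {B₁ B₂ A l : ℝ} (hcol2 : ∀ j, ∑ i, D.X i j ^ 2 ≤ B₁ * n)
    (hcolmax : ∀ j i, |D.X i j| ≤ B₂ * Real.sqrt (n / Real.log p)) (hA : 0 < A)
    (hA2 : 16 * (B₁ * v + 1 / 2 * A * B₂ * M) < A ^ 2)
    (hl : l = A * Real.sqrt (Real.log p / n)) :
    P {ω | ∃ j, l / 2 < |gradLoss 𝓕.b D.X (fun i => Y i ω) D.βs j|}
      ≤ ENNReal.ofReal (2 / p) := by
  have hn' : (0 : ℝ) < n := Nat.cast_pos.2 hn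
  have hp' : (0 : ℝ) < p := Nat.cast_pos.2 (by omega)
  have hlogp : 0 < Real.log p := Real.log_pos (by exact_mod_cast hp)
  have hB₁ : 0 ≤ B₁ := by
    have := (Finset.sum_nonneg fun i _ => sq_nonneg (D.X i ⟨0, by omega⟩)).trans (hcol2 ⟨0, by omega⟩)
    exact nonneg_of_mul_nonneg_left this hn'
  have hB₂ : 0 ≤ B₂ := by
    have := (abs_nonneg _).trans (hcolmax ⟨0, by omega⟩ ⟨0, hn⟩)
    exact nonneg_of_mul_nonneg_left this (Real.sqrt_pos.2 (by positivity))
  set q := Real.sqrt (Real.log p / n) with hq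
  have hqpos : 0 < q := Real.sqrt_pos.2 (by positivity)
  have hq2 : n * q ^ 2 = Real.log p := by
    rw [hq, Real.sq_sqrt (by positivity), mul_div_cancel₀ _ hn'.ne']
  have hqi : Real.sqrt (n / Real.log p) = q⁻¹ := by rw [hq, ← Real.sqrt_inv, inv_div]
  have hone : ∀ j, P {ω | n * l / 2 ≤ |∑ i, D.X i j * noise D 𝓕.b Y i ω|}
      ≤ 2 * ENNReal.ofReal (Real.exp (-(2 * Real.log p))) := by
    intro j
    -- The Chernoff parameter `8 q / A` turns the linear term of the exponent into `-4 log p`. The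
    -- condition on `A²` makes it admissible (`8 B₂ M ≤ A`) and bounds the quadratic term by `2 log
    -- p`. Each column then contributes at most `2 p⁻²`.
    refine (measure_abs_weighted_sum_ge_le hM hv (measurable_noise hY) (iIndepFun_noise hind)
      hmom (integral_noise hY hlaw hM hmom) (fun i => D.X i j) (hcol2 j)
      (t := 8 / A * q) (by positivity) (fun i => ?_) _).trans ?_
    · have h1 := hcolmax j i
      rw [hqi] at h1
      calc 8 / A * q * |D.X i j| * M ≤ 8 / A * q * (B₂ * q⁻¹) * M := by gcongr
        _ = 8 * B₂ * M / A := by field_simp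
        _ ≤ 1 := by
          rw [div_le_one hA]
          have : 0 ≤ B₁ * v := by positivity
          nlinarith
    · gcongr
      have e1 : -(8 / A * q) * (n * l / 2) = -(4 * Real.log p) := by
        rw [hl, ← hq2]; field_simp; ring
      have e2 : (8 / A * q) ^ 2 * (B₁ * n) * v / 2 = 32 * (B₁ * v) / A ^ 2 * Real.log p := by
        rw [← hq2]; field_simp; ring
      have e3 : 32 * (B₁ * v) / A ^ 2 ≤ 2 := by
        rw [div_le_iff₀ (by positivity)]
        have : 0 ≤ A * B₂ * M := by positivity
        linarith
      rw [e1, e2]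
      nlinarith
  calc P {ω | ∃ j, l / 2 < |gradLoss 𝓕.b D.X (fun i => Y i ω) D.βs j|}
      ≤ P (⋃ j, {ω | n * l / 2 ≤ |∑ i, D.X i j * noise D 𝓕.b Y i ω|}) := by
        refine measure_mono fun ω hω => ?_
        obtain ⟨j, hj⟩ := hω
        refine Set.mem_iUnion.2 ⟨j, ?_⟩
        rw [gradLoss_truth, abs_mul, abs_neg, abs_of_pos (by positivity), one_div,
          lt_inv_mul_iff₀ hn'] at hj
        have : n * l / 2 = n * (l / 2) := by ring
        exact this.le.trans hj.le
    _ ≤ ∑ j, P {ω | n * l / 2 ≤ |∑ i, D.X i j * noise D 𝓕.b Y i ω|} := measure_iUnion_fintype_le _ _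
    _ ≤ ∑ _j : Fin p, 2 * ENNReal.ofReal (Real.exp (-(2 * Real.log p))) :=
        Finset.sum_le_sum fun j _ => hone j
    _ = ENNReal.ofReal (2 / p) := by
        have e : Real.exp (-(2 * Real.log p)) = ((p : ℝ) ^ 2)⁻¹ := by
          rw [Real.exp_neg, two_mul, Real.exp_add, Real.exp_log hp', sq]
        rw [Finset.sum_const, Finset.card_univ, Fintype.card_fin, nsmul_eq_mul, e,
          show (2 : ℝ≥0∞) = ENNReal.ofReal 2 by simp, ← ENNReal.ofReal_natCast,
          ← ENNReal.ofReal_mul (by positivity), ← ENNReal.ofReal_mul (by positivity)]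
        congr 1
        field_simp

/-- The Euclidean norm of the gradient at the true vector, restricted to `M ∪ S`. -/
theorem measure_sum_gradLoss_truth_sq_gt_le (hn : 0 < n) (hY : ∀ i, Measurable (Y i))
    (hind : iIndepFun Y P)
    (hlaw : ∀ i, P.map (Y i) = 𝓕.law ((D.X *ᵥ D.βs) i)) (hM : 0 < M) (hv : 0 < v)
    (hmom : ∀ i, ∫⁻ ω, ENNReal.ofReal ((Real.exp (|noise D 𝓕.b Y i ω| / M) - 1
      - |noise D 𝓕.b Y i ω| / M) * M ^ 2) ∂P ≤ ENNReal.ofReal (v / 2))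
    {B₁ T : ℝ} (hcol2 : ∀ j, ∑ i, D.X i j ^ 2 ≤ B₁ * n)
    (hT : 0 < T) (hpos : 0 < (D.S.card : ℝ) + D.M.card) :
    P {ω | T ^ 2 * (((D.S.card : ℝ) + D.M.card) / n)
        < ∑ j ∈ D.MS, gradLoss 𝓕.b D.X (fun i => Y i ω) D.βs j ^ 2}
      ≤ ENNReal.ofReal (B₁ * v / T ^ 2) := by
  have hn' : (0 : ℝ) < n := Nat.cast_pos.2 hn
  set N : ℝ := (D.S.card : ℝ) + D.M.card with hN
  set f : Ω → ℝ := fun ω => ∑ j ∈ D.MS, gradLoss 𝓕.b D.X (fun i => Y i ω) D.βs j ^ 2 with hf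
  have hj : ∀ j, Integrable (fun ω => gradLoss 𝓕.b D.X (fun i => Y i ω) D.βs j ^ 2) P ∧
      ∫ ω, gradLoss 𝓕.b D.X (fun i => Y i ω) D.βs j ^ 2 ∂P ≤ B₁ * v / n := by
    intro j
    obtain ⟨h1, h2⟩ := integral_weighted_sum_sq_le hM hv (measurable_noise hY)
      (iIndepFun_noise (D := D) (b := 𝓕.b) hind) hmom (integral_noise hY hlaw hM hmom)
      (fun i => D.X i j)
    have e : (fun ω => gradLoss 𝓕.b D.X (fun i => Y i ω) D.βs j ^ 2)
        = fun ω => (1 / (n : ℝ)) ^ 2 * (∑ i, D.X i j * noise D 𝓕.b Y i ω) ^ 2 := by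
      funext ω
      rw [gradLoss_truth]; ring
    rw [e, integral_const_mul]
    refine ⟨h1.const_mul _, ?_⟩
    have h3 : (∑ i, D.X i j ^ 2) * v ≤ B₁ * n * v := by gcongr; exact hcol2 j
    calc (1 / (n : ℝ)) ^ 2 * ∫ ω, (∑ i, D.X i j * noise D 𝓕.b Y i ω) ^ 2 ∂P
        ≤ (1 / (n : ℝ)) ^ 2 * (B₁ * n * v) := by gcongr; exact h2.trans h3
      _ = B₁ * v / n := by field_simp
  have hfi : Integrable f P := integrable_finsetSum _ fun j _ => (hj j).1
  have hfE : ∫ ω, f ω ∂P ≤ N * (B₁ * v / n) := by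
    rw [hf, integral_finsetSum _ fun j _ => (hj j).1]
    refine (Finset.sum_le_sum fun j _ => (hj j).2).trans (le_of_eq ?_)
    rw [Finset.sum_const, nsmul_eq_mul, Problem.card_MS]
  -- Markov's inequality: a tail of order `T⁻²` is enough, since `T` is sent to infinity last.
  have hmk := mul_meas_ge_le_integral_of_nonneg
    (ae_of_all P fun ω => Finset.sum_nonneg fun j _ => sq_nonneg _) hfi (T ^ 2 * (N / n))
  have h4 : P.real {ω | T ^ 2 * (N / n) ≤ f ω} ≤ B₁ * v / T ^ 2 := by
    have h5 := hmk.trans hfE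
    rw [le_div_iff₀ (by positivity)]
    have h6 : 0 < N / n := by positivity
    have h7 : T ^ 2 * (N / n) * P.real {ω | T ^ 2 * (N / n) ≤ f ω}
        = (N / n) * (P.real {ω | T ^ 2 * (N / n) ≤ f ω} * T ^ 2) := by ring
    have h8 : N * (B₁ * v / n) = (N / n) * (B₁ * v) := by ring
    rw [h7, h8] at h5
    exact le_of_mul_le_mul_left h5 h6
  calc P {ω | T ^ 2 * (N / n) < f ω} ≤ P {ω | T ^ 2 * (N / n) ≤ f ω} :=
        measure_mono fun ω (hω : _ < f ω) => hω.le
    _ = ENNReal.ofReal (P.real {ω | T ^ 2 * (N / n) ≤ f ω}) := (ofReal_measureReal).symm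
    _ ≤ _ := ENNReal.ofReal_le_ofReal h4

end GradientAtTruth

/-! ### Asymptotics -/

/-- For a given `ε`, first fix `T` with `C / T²` below `ε / 2`, then take `n` large depending on
`T`. -/
theorem tendsto_zero_of_forall_le_add {f g : ℕ → ℝ≥0∞} {C : ℝ} (hg : Tendsto g atTop (𝓝 0))
    (h : ∀ T : ℝ, 0 < T → ∀ᶠ n in atTop, f n ≤ g n + ENNReal.ofReal (C / T ^ 2)) :
    Tendsto f atTop (𝓝 0) := by
  rw [ENNReal.tendsto_nhds_zero]
  intro ε hε
  have hT : Tendsto (fun T : ℝ => ENNReal.ofReal (C / T ^ 2)) atTop (𝓝 0) := by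
    rw [← ENNReal.ofReal_zero]
    exact ENNReal.tendsto_ofReal (tendsto_const_nhds.div_atTop (tendsto_pow_atTop two_ne_zero))
  have hε2 : 0 < ε / 2 := ENNReal.half_pos hε.ne'
  obtain ⟨T, hT1, hT0⟩ := ((ENNReal.tendsto_nhds_zero.1 hT _ hε2).and (eventually_gt_atTop 0)).exists
  filter_upwards [h T hT0, ENNReal.tendsto_nhds_zero.1 hg _ hε2] with n h1 h2
  calc f n ≤ ε / 2 + ε / 2 := h1.trans (add_le_add h2 hT1)
    _ = ε := ENNReal.add_halves ε

theorem posSemidef_smul_one_sub_mono {ι : Type*} [Finite ι] [DecidableEq ι] {G : Matrix ι ι ℝ}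
    {x z : ℝ} (h : (x • (1 : Matrix ι ι ℝ) - G).PosSemidef) (hxz : x ≤ z) :
    (z • (1 : Matrix ι ι ℝ) - G).PosSemidef := by
  have e : z • (1 : Matrix ι ι ℝ) - G = (z - x) • (1 : Matrix ι ι ℝ) + (x • 1 - G) := by
    rw [sub_smul]; abel
  rw [e]
  exact (Matrix.PosSemidef.one.smul (sub_nonneg.2 hxz)).add h

section Rates

variable {p r : ℕ → ℕ} {D : ∀ n : ℕ, Problem n (p n) (r n)} {lam : ℕ → ℝ} {b : ℝ → ℝ}

theorem eventually_mul_sqrt_le_lam (hlam : ∀ᶠ n in atTop, 0 < lam n)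
    (hrate : (fun n : ℕ => max (Real.sqrt (((D n).S.card : ℝ) + (D n).M.card))
        (Real.sqrt (Real.log (p n))) / Real.sqrt n) =o[atTop] lam) {C : ℝ} (hC : 0 < C) :
    ∀ᶠ n : ℕ in atTop, C * Real.sqrt ((((D n).S.card : ℝ) + (D n).M.card) / n) ≤ lam n ∧
      C * Real.sqrt (Real.log (p n) / n) ≤ lam n := by
  filter_upwards [hlam, hrate.bound (inv_pos.2 hC)] with n h1 h2
  rw [Real.norm_of_nonneg (by positivity), Real.norm_of_nonneg h1.le, le_inv_mul_iff₀ hC] at h2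
  rw [Real.sqrt_div' _ (Nat.cast_nonneg n), Real.sqrt_div' _ (Nat.cast_nonneg n)]
  constructor
  · refine le_trans ?_ h2
    gcongr
    exact le_max_left _ _
  · refine le_trans ?_ h2
    gcongr
    exact le_max_right _ _

theorem eventually_mul_le_sqrt {N : ℕ → ℝ} (hN : ∀ n, 0 ≤ N n)
    (h : N =o[atTop] fun n : ℕ => (n : ℝ) ^ (1 / 2 : ℝ)) {C : ℝ} (hC : 0 ≤ C) :
    ∀ᶠ n : ℕ in atTop, C * N n ≤ Real.sqrt n := by
  filter_upwards [h.bound (show 0 < (C + 1)⁻¹ by positivity)] with n h1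
  rw [← Real.sqrt_eq_rpow, Real.norm_of_nonneg (hN n), Real.norm_of_nonneg (Real.sqrt_nonneg _),
    le_inv_mul_iff₀ (by positivity)] at h1
  linarith [hN n]

/-- Deterministic part of the consistency of the oracle estimators. -/
theorem eventually_oracle_bounds (hb : ContDiff ℝ 3 b) (h2 : ∀ t, 0 ≤ iteratedDeriv 2 b t)
    (hlam : ∀ᶠ n in atTop, 0 < lam n) (hpos : ∀ᶠ n in atTop, (D n).A.Nonempty)
    (hrate : (fun n : ℕ => max (Real.sqrt (((D n).S.card : ℝ) + (D n).M.card))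
        (Real.sqrt (Real.log (p n))) / Real.sqrt n) =o[atTop] lam)
    (hminHess : ∃ c : ℝ, 0 < c ∧ ∀ᶠ n in atTop, ∀ β ∈ (D n).N0,
      (weightedGram (D n).X (D n).MS (fun i => iteratedDeriv 2 b (((D n).X *ᵥ β) i))
        - (c * n) • (1 : Matrix (D n).MS (D n).MS ℝ)).PosSemidef)
    (hthird : ∃ L : ℝ, ∀ᶠ n in atTop, ∀ β ∈ (D n).N0, ∀ j : Fin (p n),
      ((L * n) • (1 : Matrix (D n).MS (D n).MS ℝ)
        - weightedGram (D n).X (D n).MS (fun i =>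
            |(D n).X i j| * |iteratedDeriv 3 b (((D n).X *ᵥ β) i)|)).PosSemidef)
    (hmaxHess : ∃ L : ℝ, ∀ᶠ n : ℕ in atTop,
      ((L * n) • (1 : Matrix (D n).MS (D n).MS ℝ)
        - weightedGram (D n).X (D n).MS (fun i =>
            iteratedDeriv 2 b (((D n).X *ᵥ (D n).βs) i))).PosSemidef)
    (hcross : ∃ L : ℝ, ∀ᶠ n in atTop, ∀ j ∉ (D n).MS,
      ∑ k ∈ (D n).MS, |((D n).Xᵀ * Matrix.diagonal (fun i =>
        iteratedDeriv 2 b (((D n).X *ᵥ (D n).βs) i)) * (D n).X) j k| ≤ L * n)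
    (hsparse : (fun n => ((D n).S.card : ℝ) + (D n).M.card)
      =o[atTop] fun n : ℕ => (n : ℝ) ^ (1 / 2 : ℝ))
    {a a₁ A : ℝ} (ha₁ : 0 < a₁) (hA : 0 < A)
    (hsignal : ∀ᶠ n in atTop, ∀ j ∈ (D n).S, (a + 1) * lam n < |(D n).βs j|)
    {T H : ℝ} (hT : 0 ≤ T) (hH : 0 ≤ H) :
    ∀ᶠ n : ℕ in atTop, ∀ (y : Fin n → ℝ) (d β : Fin (p n) → ℝ),
      (∀ j, |gradLoss b (D n).X y (D n).βs j| ≤ A * Real.sqrt (Real.log (p n) / n) / 2) →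
      ∑ j ∈ (D n).MS, gradLoss b (D n).X y (D n).βs j ^ 2
        ≤ T ^ 2 * ((((D n).S.card : ℝ) + (D n).M.card) / n) →
      (∀ j ∉ (D n).MS, d j = 0) →
      l2norm d ≤ H * Real.sqrt ((((D n).S.card : ℝ) + (D n).M.card) / n) →
      β ∈ (D n).oracleSpace →
      loss b (D n).X y β ≤ loss b (D n).X y ((D n).βs + d) →
      (∀ j ∉ (D n).MS, |gradLoss b (D n).X y β j| < a₁ * lam n) ∧
      ∀ j ∈ (D n).S, a * lam n < |β j| := by
  obtain ⟨c, hc, hmin⟩ := hminHess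
  obtain ⟨L₃', hthird⟩ := hthird
  obtain ⟨L', hmax⟩ := hmaxHess
  obtain ⟨Lc', hcr⟩ := hcross
  -- The constants hidden in the `O(n)` conditions carry no sign; enlarging them to be nonnegative
  -- preserves the bounds.
  set L₃ := max L₃' 0
  set L := max L' 0
  set Lc := max Lc' 0
  have hL₃ : 0 ≤ L₃ := le_max_right _ _
  have hL : 0 ≤ L := le_max_right _ _
  have hLc : 0 ≤ Lc := le_max_right _ _
  -- Chosen so that `c R / 2` exceeds `T + L H + 1` by exactly one. The total distance from `β*` is
  -- then at most `Q ρ` with `Q = R + H`.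
  set R := 2 * (T + L * H + 2) / c with hR
  have hRc : c * R / 2 = T + L * H + 2 := by rw [hR]; field_simp
  have hR0 : 0 ≤ R := by positivity
  set Q := R + H with hQ
  have hQ0 : 0 ≤ Q := add_nonneg hR0 hH
  have hlog : ∀ᶠ n : ℕ in atTop, Q ^ 2 ≤ Real.log n :=
    (Real.tendsto_log_atTop.comp tendsto_natCast_atTop_atTop).eventually_ge_atTop _
  have hN0 : ∀ n, 0 ≤ ((D n).S.card : ℝ) + (D n).M.card := fun n => by positivity
  -- The rate of `lam` is used with four constants: `Q + 1` for the signals on `S`, and three that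
  -- bound the linear term, the quadratic term and the noise in the gradient by `a₁ * lam / 4` each,
  -- leaving a strict gap.
  filter_upwards [hlam, hpos, hmin, hthird, hmax, hcr, hsignal, hlog, eventually_gt_atTop 0,
    eventually_mul_le_sqrt hN0 hsparse (C := L₃ * H ^ 2) (by positivity),
    eventually_mul_le_sqrt hN0 hsparse (C := 1) zero_le_one,
    eventually_mul_sqrt_le_lam hlam hrate (C := Q + 1) (by positivity),
    eventually_mul_sqrt_le_lam hlam hrate (C := 4 * (Lc * Q + 1) / a₁) (by positivity),
    eventually_mul_sqrt_le_lam hlam hrate (C := 4 * (L₃ * Q ^ 2 + 1) / a₁) (by positivity),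
    eventually_mul_sqrt_le_lam hlam hrate (C := 2 * A / a₁) (by positivity)] with
    n hlam hAne hmin hthird hmax hcr hsignal hlog hn hsm1 hsm2 hr1 hr2 hr3 hr4
  intro y d β hg1 hg2 hd hdH hβ hle
  have hn' : (0 : ℝ) < n := Nat.cast_pos.2 hn
  have hN : 0 < ((D n).S.card : ℝ) + (D n).M.card := by
    rw [← Problem.card_MS]
    obtain ⟨j, hj⟩ := hAne
    exact Nat.cast_pos.2 (Finset.card_pos.2 ⟨j, Problem.mem_MS.2 (Or.inr hj)⟩)
  have hthird' : ∀ β ∈ (D n).N0, ∀ j : Fin (p n),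
      ((L₃ * n) • (1 : Matrix (D n).MS (D n).MS ℝ)
        - weightedGram (D n).X (D n).MS (fun i =>
            |(D n).X i j| * |iteratedDeriv 3 b (((D n).X *ᵥ β) i)|)).PosSemidef :=
    fun β hβ j => posSemidef_smul_one_sub_mono (hthird β hβ j)
      (mul_le_mul_of_nonneg_right (le_max_left _ _) hn'.le)
  have hmax' := posSemidef_smul_one_sub_mono hmax (z := L * n)
    (mul_le_mul_of_nonneg_right (le_max_left _ _) hn'.le)
  have hcr' : ∀ j ∉ (D n).MS, ∑ k ∈ (D n).MS, |((D n).Xᵀ * Matrix.diagonal (fun i =>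
      iteratedDeriv 2 b (((D n).X *ᵥ (D n).βs) i)) * (D n).X) j k| ≤ Lc * n := fun j hj =>
    (hcr j hj).trans (mul_le_mul_of_nonneg_right (le_max_left _ _) hn'.le)
  set v := β - (D n).βs with hv
  have hvβ : (D n).βs + v = β := by rw [hv]; abel
  have hv0 : ∀ j ∉ (D n).MS, v j = 0 := fun j hj => by
    rw [hv, Pi.sub_apply, hβ j hj, Problem.βs_eq_zero_of_notMem hj, sub_zero]
  rw [← hvβ] at hle
  have hvd := Problem.l2norm_sub_le_of_loss_le hn hb h2 hc hL hL₃ hT hH hR0 hmin hthird' hmax' hsm1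
    hlog (by linarith) hN hg2 hd hdH hv0 hle
  set ρ := Real.sqrt ((((D n).S.card : ℝ) + (D n).M.card) / n) with hρ
  have hρ0 : 0 ≤ ρ := Real.sqrt_nonneg _
  have hρ1 : ρ ≤ 1 := by
    have h1 : (1 : ℝ) ≤ n := by exact_mod_cast hn
    refine Real.sqrt_le_iff.2 ⟨zero_le_one, ?_⟩
    rw [one_pow, div_le_one hn']
    exact (one_mul _).symm.le.trans (hsm2.trans (Real.sqrt_le_iff.2 ⟨hn'.le, by nlinarith⟩))
  have hvQ : l2norm v ≤ Q * ρ := by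
    have := l2norm_add_le (v - d) d
    rw [sub_add_cancel] at this
    rw [hQ, add_mul]
    linarith
  have hl0 := l2norm_nonneg v
  constructor
  · intro j hj
    have h := Problem.abs_gradLoss_add_le (y := y) hn hb hthird' hcr' hv0
      (hvQ.trans (Problem.mul_sqrt_le_radius hlog)) hj
    rw [hvβ] at h
    have e1 : Lc * l2norm v ≤ a₁ * lam n / 4 := by
      have h3 := hr2.1
      rw [div_mul_eq_mul_div, div_le_iff₀ ha₁] at h3
      have : Lc * l2norm v ≤ Lc * (Q * ρ) := by gcongr
      linarith
    have e2 : L₃ * l2norm v ^ 2 / 2 ≤ a₁ * lam n / 4 := by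
      have h3 := hr3.1
      rw [div_mul_eq_mul_div, div_le_iff₀ ha₁] at h3
      have h4 : L₃ * l2norm v ^ 2 ≤ L₃ * (Q * ρ) ^ 2 := by gcongr
      have h5 : L₃ * (Q * ρ) ^ 2 ≤ L₃ * Q ^ 2 * ρ := by
        have : L₃ * (Q * ρ) ^ 2 = L₃ * Q ^ 2 * (ρ * ρ) := by ring
        rw [this]
        gcongr
        exact mul_le_of_le_one_left hρ0 hρ1
      have h6 : 0 ≤ L₃ * Q ^ 2 * ρ := by positivity
      linarith
    have e3 : A * Real.sqrt (Real.log (p n) / n) / 2 ≤ a₁ * lam n / 4 := by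
      have h3 := hr4.2
      rw [div_mul_eq_mul_div, div_le_iff₀ ha₁] at h3
      linarith
    have e4 : 0 < a₁ * lam n := by positivity
    linarith [hg1 j]
  · intro j hj
    have h3 := hsignal j hj
    have h4 := abs_le_l2norm v j
    have h5 := abs_sub_abs_le_abs_sub ((D n).βs j) (β j)
    rw [abs_sub_comm] at h5
    have h6 : |β j - (D n).βs j| = |v j| := rfl
    linarith [hr1.1]

end Rates

end PPGLM

/-! ### Assembly of the deterministic and probabilistic parts -/

theorem mainTheorem2
    -- the exponential family, the dimensions and the testing problems
    (𝓕 : ExpFamily) (p r : ℕ → ℕ) (D : ∀ n : ℕ, Problem n (p n) (r n))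
    -- the responses: independent, with laws in the exponential family
    {Ω : ℕ → Type*} [∀ n, MeasurableSpace (Ω n)] (P : ∀ n, Measure (Ω n))
    [∀ n, IsProbabilityMeasure (P n)]
    (Y : ∀ n, Fin n → Ω n → ℝ)
    (hYmeas : ∀ n i, Measurable (Y n i))
    (hYindep : ∀ n, iIndepFun (Y n) (P n))
    (hYlaw : ∀ n i, (P n).map (Y n i) = 𝓕.law (((D n).X *ᵥ (D n).βs) i))
    -- the assumptions are made for the sample sizes `n ≥ n₀`
    (n₀ : ℕ) (hn₀ : 1 ≤ n₀)
    -- the constraint matrix has full row rank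
    (hrank : ∀ n ≥ n₀, (D n).C.rank = r n)
    -- the ultra-high dimensional regime
    (hp : Tendsto p atTop atTop)
    (hlogp : ∃ η : ℝ, 0 < η ∧ η < 1 ∧
      (fun n => Real.log (p n)) =O[atTop] fun n : ℕ => (n : ℝ) ^ η)
    -- the folded-concave penalty, with derivative `dpen`
    (a a₁ a₂ : ℝ) (ha : 0 < a) (ha₁ : 0 < a₁) (ha₂ : 0 < a₂) (haa₂ : a₂ < a)
    (lam : ℕ → ℝ) (hlam : ∀ n ≥ n₀, 0 < lam n)
    (pen dpen : ℝ → ℝ → ℝ)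
    (hpen : ∀ n ≥ n₀, IsFoldedConcave a a₁ a₂ (lam n) (pen (lam n)) (dpen (lam n)))
    -- the oracle estimators are the unique solutions of their minimization problems
    (orc₀ orcₐ : ∀ n, Ω n → Fin (p n) → ℝ)
    (horc₀ : ∀ n ≥ n₀, ∀ᵐ ω ∂(P n),
      (D n).IsReducedOracle 𝓕.b (fun i => Y n i ω) (orc₀ n ω))
    (horcₐ : ∀ n ≥ n₀, ∀ᵐ ω ∂(P n),
      (D n).IsFullOracle 𝓕.b (fun i => Y n i ω) (orcₐ n ω))
    -- minimum signal strength
    (hsignal : ∀ n ≥ n₀, ∀ j ∈ (D n).S, (a + 1) * lam n < |(D n).βs j|)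
    -- the null hypothesis or local alternatives
    (hh : Tendsto (fun n => l2norm (D n).h) atTop (𝓝 0))
    (hC : ∃ L : ℝ, ∀ᶠ n in atTop,
      (L • (1 : Matrix (Fin (r n)) (Fin (r n)) ℝ) - ((D n).C * (D n).Cᵀ)⁻¹).PosSemidef)
    (hhrate : (fun n => l2norm (D n).h) =O[atTop] fun n =>
      Real.sqrt (min (((D n).S.card : ℝ) + (D n).M.card - r n) (r n) / n))
    -- rate of the penalty level
    (hlamrate : (fun n : ℕ => max (Real.sqrt (((D n).S.card : ℝ) + (D n).M.card))
        (Real.sqrt (Real.log (p n))) / Real.sqrt n) =o[atTop] lam)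
    -- eigenvalue and norm conditions on the design near the truth
    (hminHess : ∃ c : ℝ, 0 < c ∧ ∀ᶠ n in atTop, ∀ β ∈ (D n).N0,
      (weightedGram (D n).X (D n).MS (fun i => iteratedDeriv 2 𝓕.b (((D n).X *ᵥ β) i))
        - (c * n) • (1 : Matrix (D n).MS (D n).MS ℝ)).PosSemidef)
    (hthird : ∃ L : ℝ, ∀ᶠ n in atTop, ∀ β ∈ (D n).N0, ∀ j : Fin (p n),
      ((L * n) • (1 : Matrix (D n).MS (D n).MS ℝ)
        - weightedGram (D n).X (D n).MS (fun i =>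
            |(D n).X i j| * |iteratedDeriv 3 𝓕.b (((D n).X *ᵥ β) i)|)).PosSemidef)
    (hmaxHess : ∃ L : ℝ, ∀ᶠ n : ℕ in atTop,
      ((L * n) • (1 : Matrix (D n).MS (D n).MS ℝ)
        - weightedGram (D n).X (D n).MS (fun i =>
            iteratedDeriv 2 𝓕.b (((D n).X *ᵥ (D n).βs) i))).PosSemidef)
    (hcross : ∃ L : ℝ, ∀ᶠ n in atTop, ∀ j ∉ (D n).MS,
      ∑ k ∈ (D n).MS, |((D n).Xᵀ * Matrix.diagonal (fun i =>
        iteratedDeriv 2 𝓕.b (((D n).X *ᵥ (D n).βs) i)) * (D n).X) j k| ≤ L * n)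
    -- size of the columns of the design matrix
    (B₁ B₂ : ℝ)
    (hcol2 : ∀ n ≥ n₀, ∀ j, ∑ i, (D n).X i j ^ 2 ≤ B₁ * n)
    (hcolmax : ∀ n ≥ n₀, ∀ j i, |(D n).X i j| ≤ B₂ * Real.sqrt (n / Real.log (p n)))
    -- exponential moments of the errors
    (M₀ v₀ : ℝ) (hM₀ : 0 < M₀) (hv₀ : 0 < v₀)
    (hmoment : ∀ n ≥ n₀, ∀ i : Fin n,
      ∫⁻ ω, ENNReal.ofReal
        ((Real.exp (|Y n i ω - deriv 𝓕.b (((D n).X *ᵥ (D n).βs) i)| / M₀) - 1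
          - |Y n i ω - deriv 𝓕.b (((D n).X *ᵥ (D n).βs) i)| / M₀) * M₀ ^ 2) ∂(P n)
        ≤ ENNReal.ofReal (v₀ / 2))
    -- restricted eigenvalue condition
    (κ : ℕ → ℝ) (hκpos : ∀ n ≥ n₀, 0 < κ n)
    (hκ : ∀ n ≥ n₀, (D n).IsRestrictedEigenvalue 𝓕.b (κ n))
    -- self-concordance
    (K : ℝ) (hK : 0 < K) (hconc : ∀ t : ℝ, |iteratedDeriv 3 𝓕.b t| ≤ K * iteratedDeriv 2 𝓕.b t)
    -- sparsity rate
    (hsparse : (fun n => ((D n).S.card : ℝ) + (D n).M.card)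
      =o[atTop] fun n : ℕ => (n : ℝ) ^ (1 / 2 : ℝ))
    -- the lasso estimator and its penalty level
    (A : ℝ) (hA : 0 < A) (hA2 : 16 * (B₁ * v₀ + 1 / 2 * A * B₂ * M₀) < A ^ 2)
    (lamL : ℕ → ℝ)
    (hlamL : ∀ n ≥ n₀, lamL n = A * Real.sqrt (Real.log (p n) / n))
    (hlamLκ : ∀ n ≥ n₀, lamL n ≤ κ n / (20 * K * maxNorm (D n).X * (D n).A.card))
    (las : ∀ n, Ω n → Fin (p n) → ℝ)
    (hlas : ∀ n ≥ n₀, ∀ᵐ ω ∂(P n),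
      (D n).IsLasso 𝓕.b (fun i => Y n i ω) (lamL n) (las n ω))
    -- the penalty level dominates the estimation error of the lasso
    (hlamlas : ∀ n ≥ n₀,
      5 * Real.sqrt (D n).A.card * lamL n / (min 1 a₂ * κ n) ≤ lam n) :
    -- the reduced model
    (∀ n ≥ n₀,
      P n {ω | ¬ (D n).LLAConvergesInTwoSteps 𝓕.b (fun i => Y n i ω) (dpen (lam n))
          (D n).reduced (las n ω) (orc₀ n ω)}
        ≤ (D n).delta0 (P n) (las n) (min 1 a₂ * lam n)
          + (D n).delta1 (P n) 𝓕.b (Y n) (orc₀ n) (a₁ * lam n)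
          + (D n).delta2 (P n) (orc₀ n) (a * lam n)) ∧
    -- the full model
    (∀ n ≥ n₀,
      P n {ω | ¬ (D n).LLAConvergesInTwoSteps 𝓕.b (fun i => Y n i ω) (dpen (lam n))
          (D n).full (las n ω) (orcₐ n ω)}
        ≤ (D n).delta0 (P n) (las n) (min 1 a₂ * lam n)
          + (D n).delta1 (P n) 𝓕.b (Y n) (orcₐ n) (a₁ * lam n)
          + (D n).delta2 (P n) (orcₐ n) (a * lam n)) ∧
    -- all exception probabilities vanish asymptotically
    Tendsto (fun n => (D n).delta0 (P n) (las n) (min 1 a₂ * lam n)) atTop (𝓝 0) ∧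
    Tendsto (fun n => (D n).delta1 (P n) 𝓕.b (Y n) (orc₀ n) (a₁ * lam n)) atTop (𝓝 0) ∧
    Tendsto (fun n => (D n).delta2 (P n) (orc₀ n) (a * lam n)) atTop (𝓝 0) ∧
    Tendsto (fun n => (D n).delta1 (P n) 𝓕.b (Y n) (orcₐ n) (a₁ * lam n)) atTop (𝓝 0) ∧
    Tendsto (fun n => (D n).delta2 (P n) (orcₐ n) (a * lam n)) atTop (𝓝 0) := by
  have hb := 𝓕.contDiff_b
  have h2 := iteratedDeriv_two_nonneg hK hconc
  have hmom : ∀ n ≥ n₀, ∀ i : Fin n, ∫⁻ ω, ENNReal.ofReal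
      ((Real.exp (|noise (D n) 𝓕.b (Y n) i ω| / M₀) - 1
        - |noise (D n) 𝓕.b (Y n) i ω| / M₀) * M₀ ^ 2) ∂(P n) ≤ ENNReal.ofReal (v₀ / 2) := hmoment
  have hlam' : ∀ᶠ n in atTop, 0 < lam n := (eventually_ge_atTop n₀).mono hlam
  have hAne : ∀ᶠ n in atTop, (D n).A.Nonempty := (eventually_ge_atTop n₀).mono fun n hn =>
    Problem.A_nonempty_of_isRestrictedEigenvalue (hκ n hn)
  have hp2 : ∀ᶠ n in atTop, 2 ≤ p n := hp.eventually_ge_atTop 2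
  have hpinv : Tendsto (fun n => ENNReal.ofReal (2 / p n)) atTop (𝓝 0) := by
    rw [← ENNReal.ofReal_zero]
    exact ENNReal.tendsto_ofReal
      (tendsto_const_nhds.div_atTop (tendsto_natCast_atTop_atTop.comp hp))
  have hE1 : ∀ᶠ n in atTop, P n {ω | ∃ j, lamL n / 2
      < |gradLoss 𝓕.b (D n).X (fun i => Y n i ω) (D n).βs j|} ≤ ENNReal.ofReal (2 / p n) := by
    filter_upwards [hp2, eventually_ge_atTop n₀] with n hpn hn
    exact measure_gradLoss_truth_gt_le (by omega) hpn (hYmeas n) (hYindep n) (hYlaw n) hM₀ hv₀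
      (hmom n hn) (hcol2 n hn) (hcolmax n hn) hA hA2 (hlamL n hn)
  have hE2 : ∀ T : ℝ, 0 < T → ∀ᶠ n in atTop, P n {ω |
      T ^ 2 * ((((D n).S.card : ℝ) + (D n).M.card) / n)
        < ∑ j ∈ (D n).MS, gradLoss 𝓕.b (D n).X (fun i => Y n i ω) (D n).βs j ^ 2}
      ≤ ENNReal.ofReal (B₁ * v₀ / T ^ 2) := by
    intro T hT
    filter_upwards [hAne, eventually_ge_atTop n₀] with n ⟨j, hj⟩ hn
    refine measure_sum_gradLoss_truth_sq_gt_le (by omega) (hYmeas n) (hYindep n) (hYlaw n) hM₀ hv₀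
      (hmom n hn) (hcol2 n hn) hT ?_
    rw [← Problem.card_MS]
    exact Nat.cast_pos.2 (Finset.card_pos.2 ⟨j, Problem.mem_MS.2 (Or.inr hj)⟩)
  -- Both oracles are treated at once: all that matters is a nonrandom comparison point `β* + d`
  -- with `d = O(ρ)` whose loss the estimator does not exceed.
  have horacle : ∀ orc : ∀ n, Ω n → Fin (p n) → ℝ,
      (∃ H : ℝ, 0 ≤ H ∧ ∀ᶠ n : ℕ in atTop, ∃ d : Fin (p n) → ℝ, (∀ j ∉ (D n).MS, d j = 0) ∧
        l2norm d ≤ H * Real.sqrt ((((D n).S.card : ℝ) + (D n).M.card) / n) ∧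
        ∀ᵐ ω ∂(P n), orc n ω ∈ (D n).oracleSpace ∧
          loss 𝓕.b (D n).X (fun i => Y n i ω) (orc n ω)
            ≤ loss 𝓕.b (D n).X (fun i => Y n i ω) ((D n).βs + d)) →
      Tendsto (fun n => (D n).delta1 (P n) 𝓕.b (Y n) (orc n) (a₁ * lam n)) atTop (𝓝 0) ∧
      Tendsto (fun n => (D n).delta2 (P n) (orc n) (a * lam n)) atTop (𝓝 0) := by
    rintro orc ⟨H, hH, hd⟩
    have key : ∀ T : ℝ, 0 < T → ∀ᶠ n in atTop, ∀ᵐ ω ∂(P n),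
        ((∃ j ∉ (D n).MS, a₁ * lam n
            ≤ |gradLoss 𝓕.b (D n).X (fun i => Y n i ω) (orc n ω) j|) ∨
          ∃ j ∈ (D n).S, |orc n ω j| ≤ a * lam n) →
        (∃ j, lamL n / 2 < |gradLoss 𝓕.b (D n).X (fun i => Y n i ω) (D n).βs j|) ∨
          T ^ 2 * ((((D n).S.card : ℝ) + (D n).M.card) / n)
            < ∑ j ∈ (D n).MS, gradLoss 𝓕.b (D n).X (fun i => Y n i ω) (D n).βs j ^ 2 := by
      intro T hT
      filter_upwards [hd, eventually_ge_atTop n₀,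
        eventually_oracle_bounds hb h2 hlam' hAne hlamrate hminHess hthird hmaxHess hcross hsparse
          ha₁ hA ((eventually_ge_atTop n₀).mono hsignal) hT.le hH] with n ⟨d, hd0, hdH, hω⟩ hn hmain
      filter_upwards [hω] with ω ⟨h3, h4⟩ hbad
      by_contra! hgood
      obtain ⟨h5, h6⟩ := hmain (fun i => Y n i ω) d (orc n ω)
        (fun j => by rw [← hlamL n hn]; exact hgood.1 j) hgood.2 hd0 hdH h3 h4
      rcases hbad with ⟨j, hj, h7⟩ | ⟨j, hj, h7⟩
      · exact absurd (h5 j hj) (not_lt.2 h7)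
      · exact absurd (h6 j hj) (not_lt.2 h7)
    constructor
    · refine tendsto_zero_of_forall_le_add (C := B₁ * v₀) hpinv fun T hT => ?_
      filter_upwards [key T hT, hE1, hE2 T hT] with n h3 h4 h5
      refine (measure_mono_ae ?_).trans ((measure_union_le _ _).trans (add_le_add h4 h5))
      filter_upwards [h3] with ω h6 h7
      exact h6 (Or.inl h7)
    · refine tendsto_zero_of_forall_le_add (C := B₁ * v₀) hpinv fun T hT => ?_
      filter_upwards [key T hT, hE1, hE2 T hT] with n h3 h4 h5
      refine (measure_mono_ae ?_).trans ((measure_union_le _ _).trans (add_le_add h4 h5))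
      filter_upwards [h3] with ω h6 h7
      exact h6 (Or.inr h7)
  have hred := horacle orc₀ (by
    obtain ⟨L, hL⟩ := hC
    obtain ⟨Ch, hCh⟩ := hhrate.bound
    -- Product of the constants for `‖d‖ ≤ √L ‖h‖` and for the rate of `‖h‖`; the minimum in that
    -- rate is at most `s + m`.
    refine ⟨Real.sqrt (max L 0) * max Ch 0, by positivity, ?_⟩
    filter_upwards [hL, hCh, eventually_ge_atTop n₀] with n hLn hChn hn
    obtain ⟨d, hd0, hdred, hdn⟩ := Problem.exists_reduced_near (hrank n hn) hLn
    refine ⟨d, hd0, ?_, ?_⟩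
    · rw [Real.norm_of_nonneg (l2norm_nonneg _), Real.norm_of_nonneg (Real.sqrt_nonneg _)] at hChn
      have h3 : l2norm (D n).h
          ≤ max Ch 0 * Real.sqrt ((((D n).S.card : ℝ) + (D n).M.card) / n) := by
        refine hChn.trans (mul_le_mul (le_max_left _ _) (Real.sqrt_le_sqrt ?_)
          (Real.sqrt_nonneg _) (le_max_right _ _))
        gcongr
        exact (min_le_left _ _).trans (sub_le_self _ (Nat.cast_nonneg _))
      have h4 : l2norm d ≤ Real.sqrt (max L 0) * l2norm (D n).h := by
        rw [← Real.sqrt_sq (l2norm_nonneg (D n).h), ← Real.sqrt_mul (le_max_right _ _)]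
        refine Real.le_sqrt_of_sq_le (hdn.trans ?_)
        gcongr
        exact le_max_left _ _
      rw [mul_assoc]
      exact h4.trans (by gcongr)
    · filter_upwards [horc₀ n hn] with ω hω
      exact ⟨hω.1.1.1.1, hω.1.1.2 _ ⟨fun j hj => by
        rw [Pi.add_apply, Problem.βs_eq_zero_of_notMem hj, hd0 j hj, add_zero], hdred⟩⟩)
  have hful := horacle orcₐ (by
    -- The truth itself is feasible in the full model, so `d = 0` and `H = 0`.
    refine ⟨0, le_rfl, ?_⟩
    filter_upwards [eventually_ge_atTop n₀] with n hn
    refine ⟨0, fun _ _ => rfl, by rw [l2norm_zero, zero_mul], ?_⟩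
    filter_upwards [horcₐ n hn] with ω hω
    refine ⟨hω.1.1.1, ?_⟩
    rw [add_zero]
    exact hω.1.1.2 _ fun j hj => Problem.βs_eq_zero_of_notMem hj)
  have hbound : ∀ n ≥ n₀, ∀ (F : Set (Fin (p n) → ℝ)) (orc : Ω n → Fin (p n) → ℝ),
      (∀ᵐ ω ∂(P n), IsUniqueArgmin (loss 𝓕.b (D n).X (fun i => Y n i ω))
          ((D n).oracleSpace ∩ F) (orc ω) ∧
        ∀ β ∈ F, ∑ j ∈ (D n).MS, gradLoss 𝓕.b (D n).X (fun i => Y n i ω) (orc ω) j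
          * (β j - orc ω j) = 0) →
      P n {ω | ¬ (D n).LLAConvergesInTwoSteps 𝓕.b (fun i => Y n i ω) (dpen (lam n))
          F (las n ω) (orc ω)}
        ≤ (D n).delta0 (P n) (las n) (min 1 a₂ * lam n)
          + (D n).delta1 (P n) 𝓕.b (Y n) orc (a₁ * lam n)
          + (D n).delta2 (P n) orc (a * lam n) := by
    intro n hn F orc horc
    -- Monotonicity and subadditivity hold for outer measures, so the events need not be measurable.
    refine (measure_mono_ae ?_).trans ((measure_union_le _ _).trans
      (add_le_add_left (measure_union_le _ _) _))
    filter_upwards [horc] with ω ⟨h3, h4⟩ hω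
    by_contra hgood
    apply hω
    change ¬ ((_ ∨ _) ∨ _) at hgood
    push Not at hgood
    exact Problem.llaConvergesInTwoSteps hb h2 (hpen n hn) ha₂ (hlam n hn) (hsignal n hn) h3 h4
      (fun j hj => not_lt.1 fun h => hgood.1.1 ⟨j, hj, h⟩)
      (fun j hj => not_le.1 fun h => hgood.1.2 ⟨j, hj, h⟩)
      (fun j hj => not_le.1 fun h => hgood.2 ⟨j, hj, h⟩)
  refine ⟨fun n hn => hbound n hn _ _ ?_, fun n hn => hbound n hn _ _ ?_, ?_, hred.1, hred.2,
    hful.1, hful.2⟩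
  · filter_upwards [horc₀ n hn] with ω hω
    exact ⟨hω.1, fun β hβ => hω.sum_gradLoss_mul_sub hβ⟩
  · filter_upwards [horcₐ n hn] with ω hω
    refine ⟨?_, fun β _ => hω.sum_gradLoss_mul_sub β⟩
    rw [Problem.full, Set.inter_univ]
    exact hω.1
  -- When the gradient at `β*` is at most `lamL / 2`, the `ℓ₂`-error of the lasso, hence every
  -- coordinate of it, is at most `min 1 a₂ * lam`; the exceptional event has probability at most `2
  -- / p`.
  · refine tendsto_of_tendsto_of_tendsto_of_le_of_le' tendsto_const_nhds hpinv
      (Eventually.of_forall fun _ => zero_le) ?_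
    filter_upwards [hE1, hp2, eventually_ge_atTop n₀] with n h3 hpn hn
    refine (measure_mono_ae ?_).trans h3
    filter_upwards [hlas n hn] with ω hω hbad
    by_contra hgood
    obtain ⟨j, -, hj⟩ := hbad
    have hn' : (0 : ℝ) < n := Nat.cast_pos.2 (by omega)
    have hl : 0 < lamL n := by
      have : 0 < Real.log (p n) := Real.log_pos (by exact_mod_cast hpn)
      rw [hlamL n hn]
      positivity
    have hle := Problem.l2norm_lasso_sub_le hb hK hconc (hκpos n hn) (hκ n hn) hl (hlamLκ n hn)
      (fun j => not_lt.1 fun h => hgood ⟨j, h⟩) hω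
    have h4 := abs_le_l2norm (las n ω - (D n).βs) j
    have hm : 0 < min 1 a₂ := lt_min one_pos ha₂
    have hκn := hκpos n hn
    have h5 := hlamlas n hn
    rw [div_le_iff₀ (by positivity)] at h5
    rw [le_div_iff₀ hκn] at hle
    have h6 : l2norm (las n ω - (D n).βs) ≤ min 1 a₂ * lam n := by
      refine le_of_mul_le_mul_right (hle.trans (h5.trans (le_of_eq ?_))) hκn
      ring
    exact absurd hj (not_lt.2 (h4.trans h6))
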